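/- Let $\alpha\in(0,2)$ and $\sigma_w,\sigma_b\ge 0$. Let $\mathrm{St}(\alpha,\sigma)$ be the law on $\mathbb R$ with characteristic function $t\mapsto\exp(-\sigma^\alpha|t|^\alpha)$, and for a finite measure $\Gamma$ on the unit sphere $\mathbb S^{k-1}\subset\mathbb R^k$ let $\mathrm{St}_k(\alpha,\Gamma)$ be the law on $\mathbb R^k$ with characteristic function $\mathbf t\mapsto\exp\bigl(-\int_{\mathbb S^{k-1}}|\langle \mathbf s,\mathbf t\rangle|^\alpha\,\Gamma(\mathrm d\mathbf s)\bigr)$. Let $\|\cdot\|$ be the Euclidean norm and, for $h\in\mathbb R^k$, let $\zeta_{h}=\tfrac12(\delta_{h/\|h\|}+\delta_{-h/\|h\|})$ on $\mathbb S^{k-1}$ if $h\neq0$, and $\zeta_h=0$ if $h=0$. Let $I,D\ge1$. Let the weights $w^{(1)}_{i,j}$ ($i\ge1$, $1\le j\le I$), $w^{(l)}_{i,j}$ ($2\le l\le D$, $i,j\ge1$) and the biases $b^{(l)}_i$ ($1\le l\le D$, $i\ge1$) be mutually independent random variables on a probability space, each weight with law $\mathrm{St}(\alpha,\sigma_w)$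 and each bias with law $\mathrm{St}(\alpha,\sigma_b)$. Let $\phi:\mathbb R\to\mathbb R$ be continuous with $|\phi(s)|\le a+b|s|^\beta$ for all $s\in\mathbb R$, for some $a,b>0$ and $0<\beta<1$; write $\phi\circ f$ for the element-wise application. For an $I\times k$ real matrix $\mathbf X$ ($k\ge1$) with rows $\mathbf x_1,\dots,\mathbf x_I\in\mathbb R^k$, the all-ones vector $\mathbf 1\in\mathbb R^k$, a width $n\ge1$ and $i\ge1$, define $$f_i^{(1)}(\mathbf X,n)=\sum_{j=1}^I w^{(1)}_{i,j}\mathbf x_j+b^{(1)}_i\mathbf 1,\qquad f_i^{(l)}(\mathbf X,n)=\frac1{n^{1/\alpha}}\sum_{j=1}^n w^{(l)}_{i,j}\,\bigl(\phi\circ f_j^{(l-1)}(\mathbf X,n)\bigr)+b^{(l)}_i\mathbf 1\quad(2\le l\le D),$$ so that all layers have the same width $n$. Define recursively $$\Gamma^{(1)}_{\mathbf X}=\|\sigma_b\mathbf 1\|^\alpha\zeta_{\mathbf 1}+\sigma_w^\alpha\sum_{j=1}^I\|\mathbf x_j\|^\alpha\zeta_{\mathbf x_j},\qquad \Gamma^{(l)}_{\mathbf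 X}=\|\sigma_b\mathbf 1\|^\alpha\zeta_{\mathbf 1}+\int_{\mathbb R^k}\|\sigma_w(\phi\circ f)\|^\alpha\,\zeta_{\phi\circ f}\;q^{(l-1)}_{\mathbf X}(\mathrm df),\qquad q^{(l)}_{\mathbf X}=\mathrm{St}_k(\alpha,\Gamma^{(l)}_{\mathbf X}).$$ Then for every $1\le l\le D$ there are real stochastic processes $F^{(l)}_i=(F^{(l)}_i(x))_{x\in\mathbb R^I}$, $i\ge1$, on some probability space, independent of one another, such that each $F_i^{(l)}$ is a Stable process with parameter $(\alpha,\Gamma^{(l)})$: for all $k\ge1$ and every $I\times k$ matrix $\mathbf X$ with columns $x^{(1)},\dots,x^{(k)}$, the measure $\Gamma^{(l)}_{\mathbf X}$ is finite and the vector $f_i^{(l)}(\mathbf X):=(F_i^{(l)}(x^{(1)}),\dots,F_i^{(l)}(x^{(k)}))$ has law $\mathrm{St}_k(\alpha,\Gamma^{(l)}_{\mathbf X})$. Moreover, for all $k\ge 1$ and all $\mathbf X$, the sequence $(f_i^{(l)}(\mathbf X))_{i\ge1}$ has law $\bigotimes_{i\ge1}\mathrm{St}_k(\alpha,\Gamma^{(l)}_{\mathbf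 X})$ and, as $n\to\infty$ (jointly over the layers), $$(f_i^{(l)}(\mathbf X,n))_{i\ge1}\longrightarrow(f_i^{(l)}(\mathbf X))_{i\ge1}$$ weakly in $(\mathbb R^k)^{\mathbb N}$ with the product topology. -/

import Mathlib

open MeasureTheory ProbabilityTheory Filter
open scoped ENNReal

namespace DeepStable

/-! ### Symmetric stable laws -/

/-- `μ` is the law `St(α, σ)` on `ℝ`: the symmetric centered stable law with stability `α` and
scale `σ`, with characteristic function `t ↦ exp (-σ^α |t|^α)`. -/
structure IsStableReal (α σ : ℝ) (μ : Measure ℝ) : Prop where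
  isProbabilityMeasure : IsProbabilityMeasure μ
  charFun_eq : ∀ t : ℝ, charFun μ t = ((Real.exp (-(σ ^ α * |t| ^ α)) : ℝ) : ℂ)

/-- The unit sphere `𝕊^{k-1}` of the Euclidean space `ℝ^k`. -/
abbrev Sphere (k : ℕ) : Type := Metric.sphere (0 : EuclideanSpace ℝ (Fin k)) 1

/-- `μ` is the law `St_k(α, Γ)` on `ℝ^k`: the symmetric centered stable law with stability `α` and
finite spectral measure `Γ` on the unit sphere, with characteristic function
`t ↦ exp (-∫ |⟨s, t⟩|^α Γ(ds))`. -/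
structure IsStable {k : ℕ} (α : ℝ) (Γ : Measure (Sphere k))
    (μ : Measure (EuclideanSpace ℝ (Fin k))) : Prop where
  isFiniteMeasure : IsFiniteMeasure Γ
  isProbabilityMeasure : IsProbabilityMeasure μ
  charFun_eq : ∀ t : EuclideanSpace ℝ (Fin k),
    charFun μ t = ((Real.exp (-∫ s : Sphere k, |inner ℝ s.1 t| ^ α ∂Γ) : ℝ) : ℂ)

/-- A law is determined by its characteristic function, so there is at most one `St_k(α, Γ)`. -/
theorem IsStable.unique {k : ℕ} {α : ℝ} {Γ : Measure (Sphere k)}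
    {μ ν : Measure (EuclideanSpace ℝ (Fin k))} (hμ : IsStable α Γ μ) (hν : IsStable α Γ ν) :
    μ = ν := by
  have := hμ.isProbabilityMeasure
  have := hν.isProbabilityMeasure
  refine Measure.ext_of_charFun (funext fun t => ?_)
  rw [hμ.charFun_eq, hν.charFun_eq]

open scoped Classical in
/-- The law `St_k(α, Γ)` as a measure (with the value `0` if there is no such law). -/
noncomputable def stableLaw {k : ℕ} (α : ℝ) (Γ : Measure (Sphere k)) :
    Measure (EuclideanSpace ℝ (Fin k)) :=
  if h : ∃ μ, IsStable α Γ μ then h.choose else 0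

theorem IsStable.eq_stableLaw {k : ℕ} {α : ℝ} {Γ : Measure (Sphere k)}
    {μ : Measure (EuclideanSpace ℝ (Fin k))} (hμ : IsStable α Γ μ) : μ = stableLaw α Γ := by
  have h : ∃ μ, IsStable α Γ μ := ⟨μ, hμ⟩
  rw [stableLaw, dif_pos h]
  exact hμ.unique h.choose_spec

/-! ### The network -/

/-- The indices of the weights and biases of a network with `D` layers and inputs in `ℝ^I`,
extended to infinite arrays. Layers, units and inputs are counted from `0`, so that layer `l` here
is the `(l+1)`-st layer. -/
inductive Param (I D : ℕ) : Type
  /-- The weight from the `j`-th input coordinate to the `i`-th unit of the first layer. -/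
  | inputWeight (i : ℕ) (j : Fin I) : Param I D
  /-- The weight from the `j`-th unit of layer `l` to the `i`-th unit of layer `l + 1`. -/
  | weight (l : ℕ) (hl : l + 1 < D) (i j : ℕ) : Param I D
  /-- The bias of the `i`-th unit of layer `l`. -/
  | bias (l : ℕ) (hl : l < D) (i : ℕ) : Param I D

/-- The scale of the law of each parameter: `σw` for the weights and `σb` for the biases. -/
def Param.scale {I D : ℕ} (σw σb : ℝ) : Param I D → ℝ
  | .inputWeight _ _ => σw
  | .weight _ _ _ _ => σw
  | .bias _ _ _ => σb

/-- The vector `𝟏` of `ℝ^k` with all entries `1`. -/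
noncomputable def ones (k : ℕ) : EuclideanSpace ℝ (Fin k) := WithLp.toLp 2 fun _ => 1

/-- The `j`-th row of the input matrix, as a vector of `ℝ^k`. -/
noncomputable def row {I k : ℕ} (X : Matrix (Fin I) (Fin k) ℝ) (j : Fin I) :
    EuclideanSpace ℝ (Fin k) := WithLp.toLp 2 (X j)

/-- The element-wise application `φ ∘ f` of the activation to a vector of `ℝ^k`. -/
noncomputable def act {k : ℕ} (φ : ℝ → ℝ) (f : EuclideanSpace ℝ (Fin k)) :
    EuclideanSpace ℝ (Fin k) := WithLp.toLp 2 fun r => φ (f r)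

/-- `network α φ θ X n l _ i` is the vector in `ℝ^k` of the values of the `i`-th unit of layer `l`
on the `k` columns of `X`, for the network of width `n` with parameters `θ`. -/
noncomputable def network {I D k : ℕ} (α : ℝ) (φ : ℝ → ℝ) (θ : Param I D → ℝ)
    (X : Matrix (Fin I) (Fin k) ℝ) (n : ℕ) :
    (l : ℕ) → l < D → ℕ → EuclideanSpace ℝ (Fin k)
  | 0, hl, i => ∑ j : Fin I, θ (.inputWeight i j) • row X j + θ (.bias 0 hl i) • ones k
  | l + 1, hl, i =>
      (1 / (n : ℝ) ^ (1 / α)) •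
          ∑ j ∈ Finset.range n,
            θ (.weight l hl i j) • act φ (network α φ θ X n l (Nat.lt_of_succ_lt hl) j)
        + θ (.bias (l + 1) hl i) • ones k

/-! ### The spectral measures of the limit -/

/-- The point `h / ‖h‖` of the unit sphere, for `h ≠ 0`. -/
noncomputable def direction {k : ℕ} (h : EuclideanSpace ℝ (Fin k)) (hh : h ≠ 0) : Sphere k :=
  ⟨‖h‖⁻¹ • h, by simp [norm_smul, hh]⟩

open scoped Classical in
/-- The symmetrized Dirac mass `½ (δ_{h/‖h‖} + δ_{-h/‖h‖})` on the unit sphere if `h ≠ 0`, and the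
zero measure if `h = 0`. -/
noncomputable def zeta {k : ℕ} (h : EuclideanSpace ℝ (Fin k)) : Measure (Sphere k) :=
  if hh : h ≠ 0 then
    (2 : ℝ≥0∞)⁻¹ • (Measure.dirac (direction h hh) + Measure.dirac (-direction h hh))
  else 0

/-- The mixture of measures `∫ ‖σ (φ ∘ f)‖^α ζ_{φ ∘ f} q(df)` on the unit sphere. -/
noncomputable def mixture {k : ℕ} (α σ : ℝ) (φ : ℝ → ℝ)
    (q : Measure (EuclideanSpace ℝ (Fin k))) : Measure (Sphere k) :=
  q.bind fun f => ENNReal.ofReal (‖σ • act φ f‖ ^ α) • zeta (act φ f)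

theorem measurable_direction {k : ℕ} :
    Measurable fun h : {h : EuclideanSpace ℝ (Fin k) // h ≠ 0} => direction h.1 h.2 := by
  unfold direction
  fun_prop

theorem measurable_zeta {k : ℕ} : Measurable (zeta (k := k)) := by
  classical
  unfold zeta
  refine Measurable.dite (s := {h | h ≠ 0}) (f := fun h =>
    (2 : ℝ≥0∞)⁻¹ • (Measure.dirac (direction h.1 h.2) + Measure.dirac (-direction h.1 h.2)))
    (g := fun _ => 0) ?_ measurable_const (measurableSet_singleton _).compl
  refine Measure.measurable_of_measurable_coe _ fun s hs => ?_
  have h1 : Measurable fun h : {h : EuclideanSpace ℝ (Fin k) // h ≠ 0} =>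
      Measure.dirac (direction h.1 h.2) s :=
    (Measure.measurable_coe hs).comp (Measure.measurable_dirac.comp measurable_direction)
  have hneg : Measurable fun x : Sphere k => -x :=
    (measurable_subtype_coe.neg).subtype_mk
  have h2 : Measurable fun h : {h : EuclideanSpace ℝ (Fin k) // h ≠ 0} =>
      Measure.dirac (-direction h.1 h.2) s :=
    (Measure.measurable_coe hs).comp
      (Measure.measurable_dirac.comp (hneg.comp measurable_direction))
  exact (h1.add h2).const_mul _

/-- The mixture is the set function `s ↦ ∫ ‖σ (φ ∘ f)‖^α ζ_{φ ∘ f}(s) q(df)`. -/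
theorem mixture_apply {k : ℕ} (α σ : ℝ) {φ : ℝ → ℝ} (hφ : Measurable φ)
    (q : Measure (EuclideanSpace ℝ (Fin k))) {s : Set (Sphere k)} (hs : MeasurableSet s) :
    mixture α σ φ q s =
      ∫⁻ f, ENNReal.ofReal (‖σ • act φ f‖ ^ α) * zeta (act φ f) s ∂q := by
  have hact : Measurable (act (k := k) φ) := by unfold act; fun_prop
  rw [mixture, Measure.bind_apply hs]
  · simp
  · refine (Measure.measurable_of_measurable_coe _ fun t ht => ?_).aemeasurable
    have hz := (Measure.measurable_coe ht).comp (measurable_zeta.comp hact)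
    have hc : Measurable fun f : EuclideanSpace ℝ (Fin k) => ENNReal.ofReal (‖σ • act φ f‖ ^ α) := by fun_prop
    exact hc.mul hz

/-- The spectral measure of layer `l` of the limit, for the input matrix `X`. -/
noncomputable def spectral {I k : ℕ} (α σw σb : ℝ) (φ : ℝ → ℝ)
    (X : Matrix (Fin I) (Fin k) ℝ) : ℕ → Measure (Sphere k)
  | 0 => ENNReal.ofReal (‖σb • ones k‖ ^ α) • zeta (ones k)
      + ENNReal.ofReal (σw ^ α) • ∑ j : Fin I, ENNReal.ofReal (‖row X j‖ ^ α) • zeta (row X j)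
  | l + 1 => ENNReal.ofReal (‖σb • ones k‖ ^ α) • zeta (ones k)
      + mixture α σw φ (stableLaw α (spectral α σw σb φ X l))

/-! ### Stable processes indexed by the inputs -/

/-- The vector of the values of a function on `ℝ^I` at the `k` columns of `X`. -/
noncomputable def evalColumns {I k : ℕ} (X : Matrix (Fin I) (Fin k) ℝ) (g : (Fin I → ℝ) → ℝ) :
    EuclideanSpace ℝ (Fin k) := WithLp.toLp 2 fun r => g fun j => X j r

/-- `F`, a real stochastic process indexed by `ℝ^I`, is a symmetric stable process with parameter
`(α, Γ)`: for all `k ≥ 1` and every choice `X` of `k` points (the columns of `X`), the vector of the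
values of `F` at these points has the law `St_k(α, Γ(X))`. -/
structure IsStableProcess {I : ℕ} {Ω : Type*} [MeasurableSpace Ω] (α : ℝ)
    (Γ : (k : ℕ) → Matrix (Fin I) (Fin k) ℝ → Measure (Sphere k))
    (F : (Fin I → ℝ) → Ω → ℝ) (P : Measure Ω) : Prop where
  measurable : ∀ x, Measurable (F x)
  isStable : ∀ k : ℕ, 1 ≤ k → ∀ X : Matrix (Fin I) (Fin k) ℝ,
    IsStable α (Γ k X) (P.map fun ω => evalColumns X fun x => F x ω)

end DeepStable

/-!
Given the layer below, distinct units of a layer are independent symmetric stable vectors with a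
common random spectral measure, so their joint characteristic function at `(t_a)` is the mean of
`exp (-∑ a, V (t_a))`, where `V = condExponent` contains the average over the units `j` of the layer
below of `|⟨φ ∘ f_j, t⟩| ^ α` (`integral_exp_sum_inner_network`). In particular the units are
exchangeable. The induction hypothesis `LayerConverges` is that `V` converges in `L¹` to the
exponent of the limit law and that `E V(t) ≤ C ‖t‖ ^ α` uniformly in the width.

As `|exp (-x) - exp (-y)| ≤ |x - y|` for `x, y ≥ 0`, convergence of `V` gives convergence of the
characteristic functions, hence existence of the limit stable law (Lévy and Prokhorov) and joint
convergence of any finite set of units to independent copies of it. The bound on `V` gives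
`|1 - charFun| ≤ C ‖t‖ ^ α`, hence tails of order `r ^ (-α)`, uniformly in the width; because
`β < 1` the variables `|⟨φ ∘ f_j, t⟩| ^ α` then have bounded moments of some order larger than `1`.
These two facts are the hypotheses of a weak law of large numbers
(`tendsto_integral_abs_average_sub`), which gives the convergence of `V` for the next layer
(`LayerConverges.succ`).

The limit laws for different inputs are consistent because those of the networks are, so
Kolmogorov's extension theorem (`exists_isProjectiveLimit`) gives the limit process, and the product
of countably many copies carries the independent processes. Convergence of finite sets of units is
convergence of the whole sequence in the product topology
(`tendstoInDistribution_of_forall_initial`).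
-/

namespace DeepStable

/-! ### Kolmogorov's extension theorem -/

open Topology in
/-- The content of a projective family of laws on Polish spaces is continuous at `∅`: compact
subsets of the bases of the cylinders approximate them from inside, and points of the finite
intersections of these compact cylinders have a cluster point in all of them. -/
theorem projectiveFamilyContent_tendsto_zero {ι : Type*} {α : ι → Type*}
    [∀ i, TopologicalSpace (α i)] [∀ i, PolishSpace (α i)] [∀ i, MeasurableSpace (α i)]
    [∀ i, BorelSpace (α i)] {P : ∀ J : Finset ι, Measure (Π j : J, α j)}
    [∀ J, IsProbabilityMeasure (P J)] (hP : IsProjectiveMeasureFamily P)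
    {A : ℕ → Set (Π i, α i)} (hA : ∀ n, A n ∈ measurableCylinders α) (hanti : Antitone A)
    (hinter : ⋂ n, A n = ∅) :
    Tendsto (fun n => projectiveFamilyContent hP (A n)) atTop (𝓝 0) := by
  have hmono : Antitone fun n => projectiveFamilyContent hP (A n) := fun m n hmn =>
    projectiveFamilyContent_mono hP (hA n) (hA m) (hanti hmn)
  have hlim := tendsto_atTop_iInf hmono
  by_cases hε : ⨅ n, projectiveFamilyContent hP (A n) = 0
  · rwa [hε] at hlim
  exfalso
  obtain ⟨δ, hδ0, hδ⟩ := ENNReal.exists_pos_sum_of_countable' hε ℕ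
  have hcyl : ∀ n, ∃ s S, MeasurableSet S ∧ A n = cylinder s S := fun n => by
    simpa [mem_measurableCylinders] using hA n
  choose s S mS hAS using hcyl
  have hK : ∀ n, ∃ K ⊆ S n, IsCompact K ∧ P (s n) (S n \ K) < δ n := fun n => by
    let := TopologicalSpace.upgradeIsCompletelyMetrizable
    exact (mS n).exists_isCompact_sdiff_lt (measure_ne_top _ _) (hδ0 n).ne'
  choose K hKS hKc hKδ using hK
  have hne : ∀ n, ∃ x : Π i, α i, ∀ k ≤ n, x ∈ cylinder (s k) (K k) := by
    intro n
    by_contra! hcon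
    have hmem : ∀ k, cylinder (s k) (S k \ K k) ∈ measurableCylinders α := fun k =>
      cylinder_mem_measurableCylinders _ _ ((mS k).diff (hKc k).measurableSet)
    have hsub : A n ⊆ ⋃ k ∈ Finset.range (n + 1), cylinder (s k) (S k \ K k) := by
      intro x hx
      obtain ⟨k, hk, hxk⟩ := hcon x
      have hxA : x ∈ cylinder (s k) (S k) := hAS k ▸ hanti hk hx
      simp only [Set.mem_iUnion]
      exact ⟨k, by simpa using Nat.lt_succ_of_le hk, hxA, hxk⟩
    have h1 : projectiveFamilyContent hP (A n) ≤ ∑ k ∈ Finset.range (n + 1), δ k := by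
      calc projectiveFamilyContent hP (A n)
          ≤ projectiveFamilyContent hP (⋃ k ∈ Finset.range (n + 1), cylinder (s k) (S k \ K k)) :=
            projectiveFamilyContent_mono hP (hA n)
              (isSetRing_measurableCylinders.biUnion_mem _ fun k _ => hmem k) hsub
        _ ≤ ∑ k ∈ Finset.range (n + 1),
              projectiveFamilyContent hP (cylinder (s k) (S k \ K k)) :=
            addContent_biUnion_le isSetRing_measurableCylinders fun k _ => hmem k
        _ ≤ _ := Finset.sum_le_sum fun k _ => by
            rw [projectiveFamilyContent_cylinder hP ((mS k).diff (hKc k).measurableSet)]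
            exact (hKδ k).le
    exact absurd (((iInf_le _ n).trans h1).trans (ENNReal.sum_le_tsum _)) (not_le.2 hδ)
  choose x hx using hne
  -- Along an ultrafilter the points `x n` converge at all the coordinates that matter, and the
  -- limits for different cylinders agree.
  let U : Ultrafilter ℕ := hyperfilter ℕ
  have hz : ∀ k, ∃ z ∈ K k, Tendsto (fun n => (s k).restrict (x n)) U (𝓝 z) := fun k => by
    refine (hKc k).ultrafilter_le_nhds (U.map fun n => (s k).restrict (x n)) ?_
    rw [le_principal_iff, Ultrafilter.mem_coe, Ultrafilter.mem_map]
    exact Nat.hyperfilter_le_atTop ((eventually_ge_atTop k).mono fun n hn => hx n k hn)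
  choose z hzK hz using hz
  classical
  let w : Π i, α i := fun i => if h : ∃ k, i ∈ s k then z h.choose ⟨i, h.choose_spec⟩ else x 0 i
  have hw : ∀ k, (s k).restrict w = z k := by
    intro k
    ext ⟨i, hi⟩
    have h : ∃ k, i ∈ s k := ⟨k, hi⟩
    have h1 : w i = z h.choose ⟨i, h.choose_spec⟩ := dif_pos h
    have h2 := tendsto_pi_nhds.1 (hz h.choose) ⟨i, h.choose_spec⟩
    have h3 := tendsto_pi_nhds.1 (hz k) ⟨i, hi⟩
    exact h1.trans (tendsto_nhds_unique h2 h3)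
  have : w ∈ ⋂ n, A n := Set.mem_iInter.2 fun n => by
    rw [hAS n, mem_cylinder, hw n]
    exact hKS n (hzK n)
  simp [hinter] at this

/-- **Kolmogorov's extension theorem** for Polish spaces. -/
theorem exists_isProjectiveLimit {ι : Type*} {α : ι → Type*}
    [∀ i, TopologicalSpace (α i)] [∀ i, PolishSpace (α i)] [∀ i, MeasurableSpace (α i)]
    [∀ i, BorelSpace (α i)] {P : ∀ J : Finset ι, Measure (Π j : J, α j)}
    [∀ J, IsProbabilityMeasure (P J)] (hP : IsProjectiveMeasureFamily P) :
    ∃ μ : Measure (Π i, α i), IsProjectiveLimit μ P := by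
  have hsub : (projectiveFamilyContent hP).IsSigmaSubadditive :=
    isSigmaSubadditive_of_addContent_iUnion_eq_tsum isSetRing_measurableCylinders
      fun f hf hfU hdisj => addContent_iUnion_eq_sum_of_tendsto_zero isSetRing_measurableCylinders
        (projectiveFamilyContent hP) (fun s _ => projectiveFamilyContent_ne_top hP)
        (fun _ => projectiveFamilyContent_tendsto_zero hP) hf hfU hdisj
  refine ⟨(projectiveFamilyContent hP).measure isSetSemiring_measurableCylinders
    generateFrom_measurableCylinders.ge hsub, fun J => ?_⟩
  ext s hs
  rw [Measure.map_apply (by fun_prop) hs,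
    AddContent.measure_eq _ _ generateFrom_measurableCylinders.symm]
  · exact projectiveFamilyContent_cylinder hP hs
  · exact cylinder_mem_measurableCylinders _ _ hs

/-! ### Tails, moments and characteristic functions -/

/-- A characteristic function within `C ‖t‖ ^ α` of `1` gives marginal tails of order `r ^ (-α)`. -/
theorem measureReal_abs_inner_gt_le {E : Type*} [NormedAddCommGroup E] [InnerProductSpace ℝ E]
    [MeasurableSpace E] [BorelSpace E] [SecondCountableTopology E] {μ : Measure E}
    [IsProbabilityMeasure μ] {α C : ℝ}
    (hα : 0 ≤ α) (hμ : ∀ t, ‖1 - charFun μ t‖ ≤ C * ‖t‖ ^ α) {e : E} (he : ‖e‖ = 1)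
    {r : ℝ} (hr : 0 < r) :
    μ.real {x | r < |inner ℝ e x|} ≤ 2 * C * (2 * r⁻¹) ^ α := by
  have hC : 0 ≤ C := by
    have h := hμ e
    rw [he, Real.one_rpow, mul_one] at h
    exact (norm_nonneg _).trans h
  have hr' : -(2 * r⁻¹) ≤ 2 * r⁻¹ := by rw [neg_le_self_iff]; positivity
  calc μ.real {x | r < |inner ℝ e x|}
      ≤ 2⁻¹ * r * ‖∫ t in -2 * r⁻¹..2 * r⁻¹, 1 - charFun μ (t • e)‖ :=
        measureReal_abs_inner_gt_le_integral_charFun hr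
    _ ≤ 2⁻¹ * r * ((C * (2 * r⁻¹) ^ α) * |2 * r⁻¹ - -2 * r⁻¹|) := by
        gcongr
        refine intervalIntegral.norm_integral_le_of_norm_le_const fun t ht => (hμ _).trans ?_
        rw [neg_mul, Set.uIoc_of_le hr'] at ht
        rw [norm_smul, he, mul_one, Real.norm_eq_abs]
        have : |t| ≤ 2 * r⁻¹ := abs_le.2 ⟨ht.1.le, ht.2⟩
        gcongr
    _ = 2 * C * (2 * r⁻¹) ^ α := by
        rw [show 2 * r⁻¹ - -2 * r⁻¹ = 4 * r⁻¹ by ring, abs_of_pos (by positivity)]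
        field_simp
        ring

/-- The tail bound for the Euclidean norm, by a union bound over the coordinates. -/
theorem measure_norm_gt_le {k : ℕ} {α C : ℝ} (hα : 0 ≤ α)
    {μ : Measure (EuclideanSpace ℝ (Fin k))} [IsProbabilityMeasure μ]
    (hμ : ∀ t, ‖1 - charFun μ t‖ ≤ C * ‖t‖ ^ α) {r : ℝ} (hr : 0 < r) :
    μ {x | r < ‖x‖} ≤ ENNReal.ofReal ((k * (2 * C * (2 * k) ^ α)) * r ^ (-α)) := by
  have hsub : {x : EuclideanSpace ℝ (Fin k) | r < ‖x‖} ⊆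
      ⋃ i : Fin k, {x | r / k < |inner ℝ (EuclideanSpace.single i (1 : ℝ)) x|} := by
    intro x hx
    by_contra hcon
    simp only [Set.mem_iUnion, Set.mem_ofPred_eq, not_exists, not_lt,
      EuclideanSpace.inner_single_left, map_one, one_mul] at hcon
    have h1 : ‖x‖ ≤ ∑ i, ‖x i‖ := by
      rw [EuclideanSpace.norm_eq]
      refine Real.sqrt_le_iff.2 ⟨by positivity, ?_⟩
      exact Finset.sum_sq_le_sq_sum_of_nonneg fun i _ => norm_nonneg _
    have h2 : ∑ i, ‖x i‖ ≤ ∑ _i : Fin k, r / k := Finset.sum_le_sum fun i _ => hcon i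
    have h3 : ∑ _i : Fin k, r / k ≤ r := by
      rcases Nat.eq_zero_or_pos k with rfl | hk
      · simpa using hr.le
      · have : (k : ℝ) ≠ 0 := by positivity
        simp only [Finset.sum_const, Finset.card_univ, Fintype.card_fin, nsmul_eq_mul]
        rw [mul_div_cancel₀ _ this]
    exact absurd hx (not_lt.2 (h1.trans (h2.trans h3)))
  rcases Nat.eq_zero_or_pos k with rfl | hk
  · have : μ {x | r < ‖x‖} ≤ 0 := (measure_mono hsub).trans (by simp)
    simpa using this
  have hk' : (0 : ℝ) < k := by positivity
  calc μ {x | r < ‖x‖}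
      ≤ ∑ i : Fin k, μ {x | r / k < |inner ℝ (EuclideanSpace.single i (1 : ℝ)) x|} :=
        (measure_mono hsub).trans (measure_iUnion_fintype_le _ _)
    _ ≤ ∑ _i : Fin k, ENNReal.ofReal (2 * C * (2 * (r / k)⁻¹) ^ α) := by
        refine Finset.sum_le_sum fun i _ => ?_
        rw [← ofReal_measureReal]
        exact ENNReal.ofReal_le_ofReal
          (measureReal_abs_inner_gt_le hα hμ (by simp) (by positivity))
    _ = _ := by
        rw [Finset.sum_const, Finset.card_univ, Fintype.card_fin, nsmul_eq_mul,
          ← ENNReal.ofReal_natCast, ← ENNReal.ofReal_mul (by positivity)]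
        congr 1
        rw [Real.rpow_neg hr.le, ← Real.inv_rpow hr.le, show 2 * (r / k)⁻¹ = (2 * k) * r⁻¹ by
          field_simp, Real.mul_rpow (by positivity) (by positivity)]
        ring

/-- Laws with a common tail bound of order `α` have a common bound on the moments of each order
`p < α`. -/
theorem exists_lintegral_norm_rpow_le (k : ℕ) {α C p : ℝ} (hC : 0 ≤ C) (hp : 0 < p) (hpα : p < α) :
    ∃ K : ℝ≥0∞, K ≠ ∞ ∧ ∀ μ : Measure (EuclideanSpace ℝ (Fin k)), IsProbabilityMeasure μ →
      (∀ t, ‖1 - charFun μ t‖ ≤ C * ‖t‖ ^ α) →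
      ∫⁻ y, ENNReal.ofReal (‖y‖ ^ p) ∂μ ≤ K := by
  set B : ℝ := k * (2 * C * (2 * k) ^ α) with hB
  have hB0 : 0 ≤ B := by positivity
  -- In the layer cake formula the tail is at most `1` for `t ≤ 1` and at most `B t ^ (-α)` for
  -- `t > 1`.
  refine ⟨ENNReal.ofReal p * ((∫⁻ t in Set.Ioc (0 : ℝ) 1, ENNReal.ofReal (t ^ (p - 1))) +
    ∫⁻ t in Set.Ioi (1 : ℝ), ENNReal.ofReal (B * t ^ (p - 1 - α))), ?_, ?_⟩
  · refine ENNReal.mul_ne_top ENNReal.ofReal_ne_top (ENNReal.add_ne_top.2 ⟨?_, ?_⟩)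
    · have h : IntegrableOn (fun t : ℝ => t ^ (p - 1)) (Set.Ioc 0 1) :=
        (intervalIntegrable_iff_integrableOn_Ioc_of_le zero_le_one).1
          (intervalIntegral.intervalIntegrable_rpow' (by linarith))
      exact h.lintegral_lt_top.ne
    · have h : IntegrableOn (fun t : ℝ => t ^ (p - 1 - α)) (Set.Ioi 1) :=
        integrableOn_Ioi_rpow_of_lt (by linarith) one_pos
      exact (h.const_mul B).lintegral_lt_top.ne
  · intro μ _ hμ
    rw [lintegral_rpow_eq_lintegral_meas_lt_mul μ (Eventually.of_forall fun _ => norm_nonneg _)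
      (by fun_prop) hp]
    gcongr
    rw [← Set.Ioc_union_Ioi_eq_Ioi (zero_le_one (α := ℝ)),
      lintegral_union measurableSet_Ioi (Set.Ioc_disjoint_Ioi le_rfl)]
    gcongr ?_ + ?_
    · refine lintegral_mono fun t => ?_
      calc _ ≤ 1 * ENNReal.ofReal (t ^ (p - 1)) := by gcongr; exact prob_le_one
        _ = _ := one_mul _
    · refine setLIntegral_mono_ae (by fun_prop) (Eventually.of_forall fun t ht => ?_)
      have ht0 : (0 : ℝ) < t := one_pos.trans ht
      calc _ ≤ ENNReal.ofReal (B * t ^ (-α)) * ENNReal.ofReal (t ^ (p - 1)) := by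
            gcongr
            exact measure_norm_gt_le (hp.trans hpα).le hμ ht0
        _ = _ := by
            rw [← ENNReal.ofReal_mul (by positivity), mul_assoc, ← Real.rpow_add ht0]
            congr 3
            ring

theorem norm_act_le {k : ℕ} {φ : ℝ → ℝ} {a b β : ℝ} (hb : 0 ≤ b) (hβ : 0 ≤ β)
    (hφ : ∀ s : ℝ, |φ s| ≤ a + b * |s| ^ β) (y : EuclideanSpace ℝ (Fin k)) :
    ‖act φ y‖ ≤ k * (a + b * ‖y‖ ^ β) := by
  have h1 : ‖act φ y‖ ≤ ∑ i, |φ (y i)| := by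
    rw [EuclideanSpace.norm_eq]
    refine Real.sqrt_le_iff.2 ⟨by positivity, ?_⟩
    exact Finset.sum_sq_le_sq_sum_of_nonneg fun i _ => abs_nonneg _
  calc ‖act φ y‖ ≤ ∑ i, |φ (y i)| := h1
    _ ≤ ∑ _i : Fin k, (a + b * ‖y‖ ^ β) := by
        refine Finset.sum_le_sum fun i _ => (hφ _).trans ?_
        have : |y i| ≤ ‖y‖ := by simpa using PiLp.norm_apply_le y i
        gcongr
    _ = _ := by simp [mul_add]

theorem continuous_act {k : ℕ} {φ : ℝ → ℝ} (hφ : Continuous φ) :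
    Continuous (act (k := k) φ) := by
  unfold act
  fun_prop

/-- The activations have uniformly bounded moments of an order `q` larger than `α`, as long as
`β q < α`: this is where the growth exponent `β < 1` is used. -/
theorem exists_integral_norm_act_rpow_le (k : ℕ) {α C q : ℝ} (hC : 0 ≤ C) {φ : ℝ → ℝ}
    (hφc : Continuous φ) {a b β : ℝ} (ha : 0 ≤ a) (hb : 0 ≤ b) (hβ : 0 < β)
    (hφ : ∀ s : ℝ, |φ s| ≤ a + b * |s| ^ β) (hq : 0 < q) (hqα : β * q < α) :
    ∃ K : ℝ, 0 ≤ K ∧ ∀ μ : Measure (EuclideanSpace ℝ (Fin k)), IsProbabilityMeasure μ →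
      (∀ t, ‖1 - charFun μ t‖ ≤ C * ‖t‖ ^ α) →
      Integrable (fun y => ‖act φ y‖ ^ q) μ ∧ ∫ y, ‖act φ y‖ ^ q ∂μ ≤ K := by
  obtain ⟨K, hK, hKμ⟩ := exists_lintegral_norm_rpow_le k (α := α) hC (mul_pos hβ hq) hqα
  set B : ℝ := (k * (a + b)) ^ q with hB
  have hB0 : 0 ≤ B := by positivity
  refine ⟨B * (1 + K.toReal), by positivity, fun μ _ hμ => ?_⟩
  have hbound : ∀ y : EuclideanSpace ℝ (Fin k), ‖act φ y‖ ^ q ≤ B * (1 + ‖y‖ ^ (β * q)) := by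
    intro y
    have h1 : a + b * ‖y‖ ^ β ≤ (a + b) * max 1 ‖y‖ ^ β := by
      have h2 : 1 ≤ max 1 ‖y‖ ^ β := Real.one_le_rpow (le_max_left _ _) hβ.le
      have h3 : ‖y‖ ^ β ≤ max 1 ‖y‖ ^ β := by gcongr; exact le_max_right _ _
      nlinarith
    calc ‖act φ y‖ ^ q ≤ (k * ((a + b) * max 1 ‖y‖ ^ β)) ^ q := by
          gcongr
          exact (norm_act_le hb hβ.le hφ y).trans (by gcongr)
      _ = B * max 1 ‖y‖ ^ (β * q) := by
          rw [← mul_assoc, Real.mul_rpow (by positivity) (by positivity), ← Real.rpow_mul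
            (by positivity)]
      _ ≤ B * (1 + ‖y‖ ^ (β * q)) := by
          gcongr
          rcases max_choice 1 ‖y‖ with h | h <;> rw [h]
          · rw [Real.one_rpow]
            exact le_add_of_nonneg_right (by positivity)
          · exact le_add_of_nonneg_left zero_le_one
  have hmeas : AEStronglyMeasurable (fun y => ‖y‖ ^ (β * q)) μ :=
    (measurable_norm.pow_const _).aestronglyMeasurable
  have hint : Integrable (fun y => ‖y‖ ^ (β * q)) μ := by
    refine ⟨hmeas, ?_⟩
    rw [hasFiniteIntegral_iff_ofReal (Eventually.of_forall fun _ => by positivity)]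
    exact (hKμ μ ‹_› hμ).trans_lt hK.lt_top
  have hintB : Integrable (fun y => B * (1 + ‖y‖ ^ (β * q))) μ :=
    ((integrable_const 1).add hint).const_mul B
  have hact := continuous_act (k := k) hφc
  refine ⟨hintB.mono' (hact.norm.measurable.pow_const _).aestronglyMeasurable
    (Eventually.of_forall fun y => ?_), ?_⟩
  · rw [Real.norm_of_nonneg (by positivity)]
    exact hbound y
  · calc ∫ y, ‖act φ y‖ ^ q ∂μ ≤ ∫ y, B * (1 + ‖y‖ ^ (β * q)) ∂μ :=
          integral_mono_of_nonneg (Eventually.of_forall fun y => by positivity) hintB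
            (Eventually.of_forall hbound)
      _ = B * (1 + ∫ y, ‖y‖ ^ (β * q) ∂μ) := by
          rw [integral_const_mul, integral_add (integrable_const 1) hint]
          simp
      _ ≤ B * (1 + K.toReal) := by
          gcongr
          rw [integral_eq_lintegral_of_nonneg_ae (Eventually.of_forall fun _ => by positivity)
            hmeas]
          exact ENNReal.toReal_mono hK (hKμ μ ‹_› hμ)

open Topology in
/-- **Lévy's continuity theorem**, with existence: a pointwise limit of characteristic functions
that is continuous at `0` is a characteristic function. -/
theorem exists_charFun_eq_of_tendsto {E : Type*} [NormedAddCommGroup E] [InnerProductSpace ℝ E]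
    [FiniteDimensional ℝ E] [MeasurableSpace E] [BorelSpace E] {μ : ℕ → ProbabilityMeasure E}
    {f : E → ℂ} (hf : ContinuousAt f 0)
    (h : ∀ t, Tendsto (fun n => charFun (μ n : Measure E) t) atTop (𝓝 (f t))) :
    ∃ ν : ProbabilityMeasure E, ∀ t, charFun (ν : Measure E) t = f t := by
  have htight := isTightMeasureSet_of_tendsto_charFun (μ := fun n => (μ n : Measure E)) hf h
  have hcomp : IsCompact (closure (Set.range μ)) := by
    refine isCompact_closure_of_isTightMeasureSet ?_
    convert htight using 1
    ext x
    simp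
  let U : Ultrafilter ℕ := hyperfilter ℕ
  obtain ⟨ν, -, hν : Tendsto μ U (𝓝 ν)⟩ := hcomp.ultrafilter_le_nhds (U.map μ)
    (le_principal_iff.2 (by
      rw [Ultrafilter.mem_coe, Ultrafilter.mem_map]
      exact univ_mem' fun n => subset_closure ⟨n, rfl⟩))
  refine ⟨ν, fun t => ?_⟩
  rw [ProbabilityMeasure.tendsto_iff_forall_integral_rclike_tendsto ℂ] at hν
  have h1 := hν (BoundedContinuousFunction.innerProbChar t)
  simp_rw [← charFun_eq_integral_innerProbChar] at h1
  exact tendsto_nhds_unique h1 ((h t).mono_left Nat.hyperfilter_le_atTop)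

/-! ### A weak law of large numbers -/

/-- The second moment of an average of bounded, almost uncorrelated variables. -/
theorem sq_integral_abs_average_le {Ω : Type*} [MeasurableSpace Ω] {P : Measure Ω}
    [IsProbabilityMeasure P] {Z : ℕ → Ω → ℝ} (hZ : ∀ j, Measurable (Z j)) {M : ℝ}
    (hM : ∀ j ω, |Z j ω| ≤ M) {ρ : ℝ} (hρ0 : 0 ≤ ρ)
    (hρ : ∀ j j', j ≠ j' → ∫ ω, Z j ω * Z j' ω ∂P ≤ ρ) {n : ℕ} (hn : 1 ≤ n) :
    (∫ ω, |(n : ℝ)⁻¹ * ∑ j ∈ Finset.range n, Z j ω| ∂P) ^ 2 ≤ M ^ 2 / n + ρ := by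
  have hn' : (0 : ℝ) < n := by positivity
  set S : Ω → ℝ := fun ω => (n : ℝ)⁻¹ * ∑ j ∈ Finset.range n, Z j ω with hS
  have hSm : Measurable S := by fun_prop
  have hSb : ∀ ω, |S ω| ≤ M := by
    intro ω
    rw [hS, abs_mul, abs_of_pos (by positivity : (0 : ℝ) < (n : ℝ)⁻¹), inv_mul_le_iff₀ hn']
    calc |∑ j ∈ Finset.range n, Z j ω| ≤ ∑ j ∈ Finset.range n, |Z j ω| :=
          Finset.abs_sum_le_sum_abs _ _
      _ ≤ ∑ _j ∈ Finset.range n, M := Finset.sum_le_sum fun j _ => hM j ω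
      _ = n * M := by simp
  have hmem : MemLp (fun ω => |S ω|) 2 P :=
    MemLp.of_bound (by fun_prop) M (Eventually.of_forall fun ω => by simpa using hSb ω)
  have hvar := variance_nonneg (fun ω => |S ω|) P
  rw [variance_eq_sub hmem] at hvar
  have hsq : ∫ ω, |S ω| ^ 2 ∂P =
      (n : ℝ)⁻¹ ^ 2 * ∑ j ∈ Finset.range n, ∑ j' ∈ Finset.range n, ∫ ω, Z j ω * Z j' ω ∂P := by
    have hint : ∀ j j', Integrable (fun ω => Z j ω * Z j' ω) P := fun j j' =>
      Integrable.of_bound (by fun_prop) (M * M) (Eventually.of_forall fun ω => by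
        rw [norm_mul]
        exact mul_le_mul (hM j ω) (hM j' ω) (norm_nonneg _) ((abs_nonneg _).trans (hM j ω)))
    simp_rw [sq_abs, hS, mul_pow, sq (∑ j ∈ Finset.range n, Z j _), Finset.sum_mul_sum]
    rw [integral_const_mul, integral_finsetSum _ fun j _ => integrable_finsetSum _
      fun j' _ => hint j j']
    congr 1
    exact Finset.sum_congr rfl fun j _ => integral_finsetSum _ fun j' _ => hint j j'
  have hterm : ∀ j ∈ Finset.range n, ∑ j' ∈ Finset.range n, ∫ ω, Z j ω * Z j' ω ∂P
      ≤ M ^ 2 + n * ρ := by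
    intro j hj
    rw [← Finset.add_sum_erase _ _ hj]
    gcongr ?_ + ?_
    · have h1 : ∀ ω, Z j ω * Z j ω ≤ M ^ 2 := fun ω => by
        rw [← sq, ← sq_abs]
        exact pow_le_pow_left₀ (abs_nonneg _) (hM j ω) 2
      calc ∫ ω, Z j ω * Z j ω ∂P ≤ ∫ _, M ^ 2 ∂P :=
            integral_mono_of_nonneg (Eventually.of_forall fun ω => mul_self_nonneg _)
              (integrable_const _) (Eventually.of_forall h1)
        _ = M ^ 2 := by simp
    · calc ∑ j' ∈ (Finset.range n).erase j, ∫ ω, Z j ω * Z j' ω ∂P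
          ≤ ∑ _j' ∈ (Finset.range n).erase j, ρ :=
            Finset.sum_le_sum fun j' hj' => hρ j j' (Finset.ne_of_mem_erase hj').symm
        _ ≤ ∑ _j' ∈ Finset.range n, ρ :=
            Finset.sum_le_sum_of_subset_of_nonneg (Finset.erase_subset _ _) fun _ _ _ => hρ0
        _ = n * ρ := by simp
  calc (∫ ω, |S ω| ∂P) ^ 2 ≤ ∫ ω, |S ω| ^ 2 ∂P := by
        simpa using sub_nonneg.1 hvar
    _ ≤ (n : ℝ)⁻¹ ^ 2 * ∑ _j ∈ Finset.range n, (M ^ 2 + n * ρ) := by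
        rw [hsq]
        gcongr with j hj
        exact hterm j hj
    _ = M ^ 2 / n + ρ := by
        rw [Finset.sum_const, Finset.card_range, nsmul_eq_mul]
        field_simp

/-- The truncation error is controlled by a moment of order `s ≥ 1`. -/
theorem sub_min_le_rpow {x M s : ℝ} (hx : 0 ≤ x) (hM : 0 < M) (hs : 1 ≤ s) :
    x - min x M ≤ x ^ s * M ^ (1 - s) := by
  rcases le_total x M with h | h
  · rw [min_eq_left h, sub_self]
    positivity
  · have hx0 : 0 < x := hM.trans_le h
    have h1 : x ^ (1 - s) ≤ M ^ (1 - s) :=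
      Real.rpow_le_rpow_of_nonpos hM h (by linarith)
    calc x - min x M ≤ x := by rw [min_eq_right h]; linarith
      _ = x ^ s * x ^ (1 - s) := by rw [← Real.rpow_add hx0]; simp
      _ ≤ _ := by gcongr

open Topology in
/-- A weak law of large numbers in `L¹` for triangular arrays whose variables, under bounded
continuous functions centered by their means under `q`, are asymptotically uncorrelated in pairs,
and whose moments of an order `s > 1` under `g` are bounded. The function `g` is truncated, and the
truncated averages are handled by their second moments. -/
theorem tendsto_integral_abs_average_sub {Ω E : Type*} [MeasurableSpace Ω] {P : Measure Ω}
    [IsProbabilityMeasure P] [TopologicalSpace E] [MeasurableSpace E] [OpensMeasurableSpace E]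
    {q : Measure E} [IsProbabilityMeasure q] {Y : ℕ → ℕ → Ω → E} (hY : ∀ n j, Measurable (Y n j))
    (hpair : ∀ h : E → ℝ, Continuous h → (∃ M, ∀ y, |h y| ≤ M) → ∃ ρ : ℕ → ℝ,
      Tendsto ρ atTop (𝓝 0) ∧ ∀ n j j', j ≠ j' →
        ∫ ω, (h (Y n j ω) - ∫ y, h y ∂q) * (h (Y n j' ω) - ∫ y, h y ∂q) ∂P ≤ ρ n)
    {g : E → ℝ} (hg : Continuous g) (hg0 : ∀ y, 0 ≤ g y) {s K : ℝ} (hs : 1 < s)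
    (hYs : ∀ n j, Integrable (fun ω => g (Y n j ω) ^ s) P ∧ ∫ ω, g (Y n j ω) ^ s ∂P ≤ K)
    (hqs : Integrable (fun y => g y ^ s) q ∧ ∫ y, g y ^ s ∂q ≤ K) :
    Tendsto (fun n : ℕ => ∫ ω, |(n : ℝ)⁻¹ * ∑ j ∈ Finset.range n, g (Y n j ω) - ∫ y, g y ∂q| ∂P)
      atTop (𝓝 0) := by
  have hK0 : 0 ≤ K := (integral_nonneg fun y => Real.rpow_nonneg (hg0 y) s).trans hqs.2
  have hdom : ∀ y, g y ≤ 1 + g y ^ s := by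
    intro y
    rcases le_total (g y) 1 with h | h
    · exact h.trans (le_add_of_nonneg_right (Real.rpow_nonneg (hg0 y) s))
    · calc g y = g y ^ (1 : ℝ) := (Real.rpow_one _).symm
        _ ≤ g y ^ s := Real.rpow_le_rpow_of_exponent_le h hs.le
        _ ≤ _ := le_add_of_nonneg_left zero_le_one
  have hgq : Integrable g q := by
    refine ((integrable_const 1).add hqs.1).mono' hg.measurable.aestronglyMeasurable
      (Eventually.of_forall fun y => ?_)
    rw [Real.norm_of_nonneg (hg0 y)]
    exact hdom y
  have hgY : ∀ n j, Integrable (fun ω => g (Y n j ω)) P := by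
    intro n j
    refine ((integrable_const 1).add (hYs n j).1).mono'
      (hg.measurable.comp (hY n j)).aestronglyMeasurable (Eventually.of_forall fun ω => ?_)
    rw [Real.norm_of_nonneg (hg0 _)]
    exact hdom _
  rw [Metric.tendsto_atTop]
  intro ε hε
  -- The level `M` of the truncation makes its error small uniformly in `n` and `j`, and under `q`.
  obtain ⟨M, hM0, hMε⟩ : ∃ M : ℝ, 0 < M ∧ K * M ^ (1 - s) < ε / 4 := by
    have h1 : Tendsto (fun M : ℝ => K * M ^ (1 - s)) atTop (𝓝 (K * 0)) := by
      have := tendsto_rpow_neg_atTop (y := s - 1) (by linarith)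
      simp only [neg_sub] at this
      exact this.const_mul K
    rw [mul_zero] at h1
    obtain ⟨M, hM⟩ := ((h1.eventually (gt_mem_nhds (by positivity : (0 : ℝ) < ε / 4))).and
      (eventually_gt_atTop 0)).exists
    exact ⟨M, hM.2, hM.1⟩
  set h : E → ℝ := fun y => min (g y) M with hh
  have hhc : Continuous h := hg.min continuous_const
  have hh0 : ∀ y, 0 ≤ h y := fun y => le_min (hg0 y) hM0.le
  have hhM : ∀ y, |h y| ≤ M := fun y => by rw [abs_of_nonneg (hh0 y)]; exact min_le_right _ _
  have hhq : Integrable h q :=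
    Integrable.of_bound hhc.measurable.aestronglyMeasurable M (Eventually.of_forall hhM)
  have hhY : ∀ n j, Integrable (fun ω => h (Y n j ω)) P := fun n j =>
    Integrable.of_bound (hhc.measurable.comp (hY n j)).aestronglyMeasurable M
      (Eventually.of_forall fun ω => hhM _)
  set c : ℝ := ∫ y, h y ∂q with hc
  have hcM : |c| ≤ M := by
    calc |c| ≤ ∫ y, |h y| ∂q := abs_integral_le_integral_abs
      _ ≤ ∫ _, M ∂q := integral_mono hhq.abs (integrable_const _) hhM
      _ = M := by simp
  obtain ⟨ρ, hρ, hρY⟩ := hpair h hhc ⟨M, hhM⟩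
  have hsmall : Tendsto (fun n : ℕ => (2 * M) ^ 2 / n + |ρ n|) atTop (𝓝 0) := by
    simpa using (tendsto_const_div_atTop_nhds_zero_nat ((2 * M) ^ 2)).add hρ.abs
  obtain ⟨N, hN⟩ := eventually_atTop.1
    (hsmall.eventually (gt_mem_nhds (by positivity : (0 : ℝ) < (ε / 4) ^ 2)))
  refine ⟨max N 1, fun n hn => ?_⟩
  have hn1 : 1 ≤ n := (le_max_right _ _).trans hn
  have hn' : (0 : ℝ) < n := by positivity
  rw [Real.dist_eq, sub_zero, abs_of_nonneg (integral_nonneg fun ω => abs_nonneg _)]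
  have hmid : ∫ ω, |(n : ℝ)⁻¹ * ∑ j ∈ Finset.range n, (h (Y n j ω) - c)| ∂P ≤ ε / 4 := by
    refine le_of_sq_le_sq ?_ (by positivity)
    refine (sq_integral_abs_average_le (M := 2 * M) (ρ := |ρ n|) (fun j => ?_) (fun j ω => ?_)
      (abs_nonneg _) (fun j j' hjj' => (hρY n j j' hjj').trans (le_abs_self _)) hn1).trans
      (hN n ((le_max_left _ _).trans hn)).le
    · exact (hhc.measurable.comp (hY n j)).sub_const _
    · calc |h (Y n j ω) - c| ≤ |h (Y n j ω)| + |c| := abs_sub _ _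
        _ ≤ 2 * M := by linarith [hhM (Y n j ω)]
  have hq' : ∫ y, g y ∂q - c ≤ K * M ^ (1 - s) := by
    rw [hc, ← integral_sub hgq hhq]
    calc ∫ y, (g y - h y) ∂q ≤ ∫ y, g y ^ s * M ^ (1 - s) ∂q :=
          integral_mono (hgq.sub hhq) (hqs.1.mul_const _) fun y =>
            sub_min_le_rpow (hg0 y) hM0 hs.le
      _ ≤ _ := by
          rw [integral_mul_const]
          gcongr
          exact hqs.2
  have hq0 : 0 ≤ ∫ y, g y ∂q - c := by
    rw [hc, ← integral_sub hgq hhq]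
    exact integral_nonneg fun y => sub_nonneg.2 (min_le_left _ _)
  have hYd : ∀ j, ∫ ω, (g (Y n j ω) - h (Y n j ω)) ∂P ≤ K * M ^ (1 - s) := by
    intro j
    calc ∫ ω, (g (Y n j ω) - h (Y n j ω)) ∂P ≤ ∫ ω, g (Y n j ω) ^ s * M ^ (1 - s) ∂P :=
          integral_mono ((hgY n j).sub (hhY n j)) ((hYs n j).1.mul_const _) fun ω =>
            sub_min_le_rpow (hg0 _) hM0 hs.le
      _ ≤ _ := by
          rw [integral_mul_const]
          gcongr
          exact (hYs n j).2
  have hdiff : ∀ j, Integrable (fun ω => g (Y n j ω) - h (Y n j ω)) P := fun j =>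
    (hgY n j).sub (hhY n j)
  have hA : Integrable (fun ω => (n : ℝ)⁻¹ * ∑ j ∈ Finset.range n,
      (g (Y n j ω) - h (Y n j ω))) P :=
    (integrable_finsetSum _ fun j _ => hdiff j).const_mul _
  have hB : Integrable (fun ω => |(n : ℝ)⁻¹ * ∑ j ∈ Finset.range n, (h (Y n j ω) - c)|) P :=
    ((integrable_finsetSum _ fun j _ => (hhY n j).sub (integrable_const c)).const_mul _).abs
  have hAB : Integrable (fun ω => ((n : ℝ)⁻¹ * ∑ j ∈ Finset.range n,
      (g (Y n j ω) - h (Y n j ω))) +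
      |(n : ℝ)⁻¹ * ∑ j ∈ Finset.range n, (h (Y n j ω) - c)|) P := hA.add hB
  have hAle : ∫ ω, (n : ℝ)⁻¹ * ∑ j ∈ Finset.range n, (g (Y n j ω) - h (Y n j ω)) ∂P
      ≤ K * M ^ (1 - s) := by
    rw [integral_const_mul, integral_finsetSum _ fun j _ => hdiff j,
      inv_mul_le_iff₀ hn']
    calc _ ≤ ∑ _j ∈ Finset.range n, K * M ^ (1 - s) := Finset.sum_le_sum fun j _ => hYd j
      _ = _ := by simp
  calc ∫ ω, |(n : ℝ)⁻¹ * ∑ j ∈ Finset.range n, g (Y n j ω) - ∫ y, g y ∂q| ∂P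
      ≤ ∫ ω, (((n : ℝ)⁻¹ * ∑ j ∈ Finset.range n, (g (Y n j ω) - h (Y n j ω))) +
          |(n : ℝ)⁻¹ * ∑ j ∈ Finset.range n, (h (Y n j ω) - c)| + (∫ y, g y ∂q - c)) ∂P := by
        refine integral_mono_of_nonneg (Eventually.of_forall fun ω => abs_nonneg _)
          (hAB.add (integrable_const _)) (Eventually.of_forall fun ω => ?_)
        have hA0 : 0 ≤ (n : ℝ)⁻¹ * ∑ j ∈ Finset.range n, (g (Y n j ω) - h (Y n j ω)) :=
          mul_nonneg (by positivity)
            (Finset.sum_nonneg fun j _ => sub_nonneg.2 (min_le_left _ _))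
        have hdec : (n : ℝ)⁻¹ * ∑ j ∈ Finset.range n, g (Y n j ω) - ∫ y, g y ∂q =
            (n : ℝ)⁻¹ * ∑ j ∈ Finset.range n, (g (Y n j ω) - h (Y n j ω)) +
            (n : ℝ)⁻¹ * ∑ j ∈ Finset.range n, (h (Y n j ω) - c) - (∫ y, g y ∂q - c) := by
          simp only [Finset.sum_sub_distrib, Finset.sum_const, Finset.card_range, nsmul_eq_mul]
          field_simp
          ring
        beta_reduce
        rw [hdec]
        refine (abs_sub _ _).trans ?_
        rw [abs_of_nonneg hq0]
        gcongr
        refine (abs_add_le _ _).trans ?_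
        rw [abs_of_nonneg hA0]
    _ ≤ K * M ^ (1 - s) + ε / 4 + K * M ^ (1 - s) := by
        rw [integral_add hAB (integrable_const _), integral_add hA hB]
        simp only [integral_const, probReal_univ, one_smul]
        gcongr
    _ < ε := by linarith

/-! ### Conditional characteristic functions of the layers -/

/-- The characteristic functional of a sum of independent variables with random coefficients that
are independent of them: integrate over the variables with the coefficients fixed. -/
theorem integral_exp_sum_mul_of_indepFun {Ω ι 𝓩 : Type*} [MeasurableSpace Ω] {P : Measure Ω}
    [IsProbabilityMeasure P] [Fintype ι] [MeasurableSpace 𝓩] {Z : Ω → 𝓩} (hZ : Measurable Z)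
    {W : ι → Ω → ℝ} (hW : ∀ i, Measurable (W i)) (hind : iIndepFun W P)
    (hZW : IndepFun Z (fun ω i => W i ω) P) {c : ι → 𝓩 → ℝ} (hc : ∀ i, Measurable (c i)) :
    ∫ ω, Complex.exp ((∑ i, c i (Z ω) * W i ω : ℝ) * Complex.I) ∂P =
      ∫ ω, ∏ i, charFun (P.map (W i)) (c i (Z ω)) ∂P := by
  have hWm : Measurable fun ω i => W i ω := measurable_pi_lambda _ hW
  have hprob : ∀ i, IsProbabilityMeasure (P.map (W i)) := fun i =>
    Measure.isProbabilityMeasure_map (hW i).aemeasurable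
  have hprobZ : IsProbabilityMeasure (P.map Z) := Measure.isProbabilityMeasure_map hZ.aemeasurable
  have hjoint := (indepFun_iff_map_prod_eq_prod_map_map hZ.aemeasurable hWm.aemeasurable).1 hZW
  rw [(iIndepFun_iff_map_fun_eq_pi_map fun i => (hW i).aemeasurable).1 hind] at hjoint
  have hFm : Measurable fun x : 𝓩 × (ι → ℝ) =>
      Complex.exp ((∑ i, c i x.1 * x.2 i : ℝ) * Complex.I) := by fun_prop
  calc ∫ ω, Complex.exp ((∑ i, c i (Z ω) * W i ω : ℝ) * Complex.I) ∂P
      = ∫ x, Complex.exp ((∑ i, c i x.1 * x.2 i : ℝ) * Complex.I)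
          ∂(P.map fun ω => (Z ω, fun i => W i ω)) := by
        rw [integral_map (by fun_prop) hFm.aestronglyMeasurable]
    _ = ∫ z, ∫ w, Complex.exp ((∑ i, c i z * w i : ℝ) * Complex.I)
          ∂(Measure.pi fun i => P.map (W i)) ∂(P.map Z) := by
        rw [hjoint, integral_prod]
        exact Integrable.of_bound hFm.aestronglyMeasurable 1 (Eventually.of_forall fun x => by
          rw [Complex.norm_exp_ofReal_mul_I])
    _ = ∫ z, ∏ i, charFun (P.map (W i)) (c i z) ∂(P.map Z) := by
        congr 1
        ext z
        simp_rw [charFun_apply_real, Complex.ofReal_sum, Finset.sum_mul, Complex.exp_sum,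
          Complex.ofReal_mul]
        exact integral_fintype_prod_eq_prod fun i (x : ℝ) =>
          Complex.exp ((c i z : ℂ) * (x : ℂ) * Complex.I)
    _ = _ := by
        rw [integral_map hZ.aemeasurable]
        have : ∀ i, Measurable fun z => charFun (P.map (W i)) (c i z) := fun i =>
          measurable_charFun.comp (hc i)
        exact (Finset.measurable_fun_prod _ fun i _ => this i).aestronglyMeasurable

/-- The characteristic functional of the units `a` of a layer with stable weights `W (a, some j)`
and stable biases `W (a, none)`: conditionally on the values `v j` of the previous layer, the units
are independent stable vectors. -/
theorem integral_exp_sum_inner_layer {Ω κ ι 𝓩 E : Type*} [MeasurableSpace Ω] {P : Measure Ω}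
    [IsProbabilityMeasure P] [Fintype κ] [Fintype ι] [MeasurableSpace 𝓩]
    [NormedAddCommGroup E] [InnerProductSpace ℝ E] [MeasurableSpace E] [BorelSpace E]
    [SecondCountableTopology E] {α σw σb : ℝ}
    {Z : Ω → 𝓩} (hZ : Measurable Z) {W : κ × Option ι → Ω → ℝ} (hW : ∀ p, Measurable (W p))
    (hind : iIndepFun W P) (hZW : IndepFun Z (fun ω p => W p ω) P)
    (hw : ∀ a j, IsStableReal α σw (P.map (W (a, some j))))
    (hb : ∀ a, IsStableReal α σb (P.map (W (a, none))))
    {v : ι → 𝓩 → E} (hv : ∀ j, Measurable (v j)) (u : E) (t : κ → E) :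
    ∫ ω, Complex.exp ((∑ a, inner ℝ (∑ j, W (a, some j) ω • v j (Z ω) + W (a, none) ω • u) (t a) :
        ℝ) * Complex.I) ∂P =
      ∫ ω, ((Real.exp (-∑ a, (σb ^ α * |inner ℝ u (t a)| ^ α +
        σw ^ α * ∑ j, |inner ℝ (v j (Z ω)) (t a)| ^ α)) : ℝ) : ℂ) ∂P := by
  let c : κ × Option ι → 𝓩 → ℝ := fun p z =>
    inner ℝ (p.2.elim u fun j => v j z) (t p.1)
  have hc : ∀ p, Measurable (c p) := by
    rintro ⟨a, _ | j⟩
    · exact (measurable_const : Measurable fun _ : 𝓩 => (inner ℝ u (t a) : ℝ))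
    · exact (hv j).inner_const
  have key := integral_exp_sum_mul_of_indepFun hZ hW hind hZW hc
  convert key using 1
  · refine integral_congr_ae (Eventually.of_forall fun ω => ?_)
    simp only [c, Fintype.sum_prod_type, Fintype.sum_option, Option.elim, inner_add_left,
      sum_inner, inner_smul_left, conj_trivial]
    congr 3
    refine Finset.sum_congr rfl fun a _ => ?_
    rw [add_comm]
    congr 1
    · ring
    · exact Finset.sum_congr rfl fun j _ => mul_comm _ _
  · refine integral_congr_ae (Eventually.of_forall fun ω => ?_)
    simp only [c, Fintype.prod_prod_type, Fintype.prod_option, Option.elim, (hw _ _).charFun_eq,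
      (hb _).charFun_eq]
    rw [← Finset.sum_neg_distrib, Real.exp_sum, Complex.ofReal_prod]
    refine Finset.prod_congr rfl fun a _ => ?_
    rw [neg_add, Real.exp_add, Complex.ofReal_mul, ← Complex.ofReal_prod, ← Real.exp_sum,
      Finset.sum_neg_distrib, Finset.mul_sum]

/-- The layer to which a parameter belongs. -/
def Param.layer {I D : ℕ} : Param I D → ℕ
  | .inputWeight _ _ => 0
  | .weight l _ _ _ => l + 1
  | .bias l _ _ => l

/-- A layer is measurable with respect to the parameters of this layer and the previous ones. -/
theorem measurable_network {Ω : Type*} {m : MeasurableSpace Ω} {I D k : ℕ} {α : ℝ} {φ : ℝ → ℝ}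
    (hφ : Continuous φ) {θ : Param I D → Ω → ℝ} (X : Matrix (Fin I) (Fin k) ℝ) (n : ℕ) :
    ∀ (l : ℕ) (hl : l < D), (∀ p : Param I D, p.layer ≤ l → Measurable (θ p)) → ∀ i,
      Measurable fun ω => network α φ (fun p => θ p ω) X n l hl i
  | 0, hl, hθ, i => by
      have h1 : ∀ j, Measurable (θ (.inputWeight i j)) := fun j => hθ _ le_rfl
      have h2 : Measurable (θ (.bias 0 hl i)) := hθ _ le_rfl
      unfold network
      fun_prop
  | l + 1, hl, hθ, i => by
      have h1 : ∀ j, Measurable (θ (.weight l hl i j)) := fun j => hθ _ le_rfl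
      have h2 : Measurable (θ (.bias (l + 1) hl i)) := hθ _ le_rfl
      have h3 := measurable_network (α := α) hφ X n l (Nat.lt_of_succ_lt hl)
        (fun p hp => hθ p (hp.trans (Nat.le_succ l)))
      have h4 : ∀ j, Measurable fun ω =>
          act φ (network α φ (fun p => θ p ω) X n l (Nat.lt_of_succ_lt hl) j) := fun j =>
        (continuous_act hφ).measurable.comp (h3 j)
      unfold network
      fun_prop

/-- The exponent at `t` of the characteristic function of a unit of layer `l` given the previous
layers, which is the same for all the units of the layer. -/
noncomputable def condExponent {I D k : ℕ} (α σw σb : ℝ) (φ : ℝ → ℝ) (θ : Param I D → ℝ)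
    (X : Matrix (Fin I) (Fin k) ℝ) (n : ℕ) :
    (l : ℕ) → l < D → EuclideanSpace ℝ (Fin k) → ℝ
  | 0, _, t => σb ^ α * |inner ℝ (ones k) t| ^ α +
      σw ^ α * ∑ j : Fin I, |inner ℝ (row X j) t| ^ α
  | l + 1, hl, t => σb ^ α * |inner ℝ (ones k) t| ^ α +
      σw ^ α * ((n : ℝ)⁻¹ * ∑ j ∈ Finset.range n,
        |inner ℝ (act φ (network α φ θ X n l (Nat.lt_of_succ_lt hl) j)) t| ^ α)

theorem measurable_condExponent {Ω : Type*} [MeasurableSpace Ω] {I D k : ℕ} {α σw σb : ℝ}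
    {φ : ℝ → ℝ} (hφ : Continuous φ) {θ : Param I D → Ω → ℝ} (hθ : ∀ p, Measurable (θ p))
    (X : Matrix (Fin I) (Fin k) ℝ) (n l : ℕ) (hl : l < D) (t : EuclideanSpace ℝ (Fin k)) :
    Measurable fun ω => condExponent α σw σb φ (fun p => θ p ω) X n l hl t := by
  cases l with
  | zero => exact measurable_const
  | succ l =>
    have h : ∀ j, Measurable fun ω =>
        act φ (network α φ (fun p => θ p ω) X n l (Nat.lt_of_succ_lt hl) j) := fun j =>
      (continuous_act hφ).measurable.comp
        (measurable_network hφ X n l (Nat.lt_of_succ_lt hl) (fun p _ => hθ p) j)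
    unfold condExponent
    refine measurable_const.add (measurable_const.mul (measurable_const.mul ?_))
    exact Finset.measurable_fun_sum _ fun j _ => ((h j).inner_const.abs.pow_const _)

theorem condExponent_nonneg {I D k : ℕ} {α σw σb : ℝ} (hσw : 0 ≤ σw) (hσb : 0 ≤ σb) (φ : ℝ → ℝ)
    (θ : Param I D → ℝ) (X : Matrix (Fin I) (Fin k) ℝ) (n l : ℕ) (hl : l < D)
    (t : EuclideanSpace ℝ (Fin k)) : 0 ≤ condExponent α σw σb φ θ X n l hl t := by
  cases l <;> unfold condExponent <;> positivity

theorem comap_fun_le_of_measurable {Ω ι : Type*} {β : ι → Type*} [∀ i, MeasurableSpace (β i)]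
    {m : MeasurableSpace Ω} {f : ∀ i, Ω → β i} (hf : ∀ i, Measurable (f i)) :
    MeasurableSpace.comap (fun ω i => f i ω) inferInstance ≤ m :=
  (measurable_pi_lambda _ hf).comap_le

theorem indepFun_network_of_lt_layer {Ω ι : Type*} [MeasurableSpace Ω] {P : Measure Ω}
    [IsProbabilityMeasure P] {I D k : ℕ} {α : ℝ} {φ : ℝ → ℝ} (hφ : Continuous φ)
    {θ : Param I D → Ω → ℝ} (hθ : ∀ p, Measurable (θ p)) (hind : iIndepFun θ P)
    (X : Matrix (Fin I) (Fin k) ℝ) (n l : ℕ) (hl : l < D) {p : ι → Param I D}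
    (hp : ∀ i, l < (p i).layer) :
    IndepFun (fun ω j => network α φ (fun p => θ p ω) X n l hl j) (fun ω i => θ (p i) ω) P := by
  let m : Param I D → MeasurableSpace Ω := fun p => MeasurableSpace.comap (θ p) inferInstance
  have hdisj : Disjoint {p : Param I D | p.layer ≤ l} {p | l < p.layer} :=
    Set.disjoint_left.2 fun p h1 => by simpa using h1
  have h := indep_iSup_of_disjoint (fun p => (hθ p).comap_le) ((iIndepFun_iff_iIndep _ θ P).1 hind)
    hdisj
  rw [IndepFun_iff_Indep]
  refine indep_of_indep_of_le_left (indep_of_indep_of_le_right h ?_) ?_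
  · refine comap_fun_le_of_measurable fun i => ?_
    exact Measurable.mono (comap_measurable (θ (p i)))
      (le_iSup₂_of_le (f := fun p (_ : p ∈ {p : Param I D | l < p.layer}) => m p) (p i) (hp i)
        le_rfl) le_rfl
  · refine comap_fun_le_of_measurable fun j => ?_
    refine measurable_network hφ X n l hl (fun p hp => ?_) j
    exact Measurable.mono (comap_measurable (θ p))
      (le_iSup₂_of_le (f := fun p (_ : p ∈ {p : Param I D | p.layer ≤ l}) => m p) p hp le_rfl)
      le_rfl

/-- The characteristic functional of distinct units of a layer. It depends on the number of the
units only, so the units are exchangeable. -/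
theorem integral_exp_sum_inner_network {Ω κ : Type*} [MeasurableSpace Ω] {P : Measure Ω}
    [IsProbabilityMeasure P] [Fintype κ] {I D k : ℕ} {α σw σb : ℝ} (hα : 0 < α)
    {θ : Param I D → Ω → ℝ} (hθ : ∀ p, Measurable (θ p))
    (hlaw : ∀ p, IsStableReal α (p.scale σw σb) (P.map (θ p))) (hind : iIndepFun θ P)
    {φ : ℝ → ℝ} (hφ : Continuous φ) (X : Matrix (Fin I) (Fin k) ℝ) (n l : ℕ) (hl : l < D)
    {idx : κ → ℕ} (hidx : Function.Injective idx) (t : κ → EuclideanSpace ℝ (Fin k)) :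
    ∫ ω, Complex.exp ((∑ a, inner ℝ (network α φ (fun p => θ p ω) X n l hl (idx a)) (t a) : ℝ) *
        Complex.I) ∂P =
      ∫ ω, ((Real.exp (-∑ a, condExponent α σw σb φ (fun p => θ p ω) X n l hl (t a)) : ℝ) : ℂ)
        ∂P := by
  cases l with
  | zero =>
    let p : κ × Option (Fin I) → Param I D := fun q =>
      q.2.elim (.bias 0 hl (idx q.1)) fun j => .inputWeight (idx q.1) j
    have hp : Function.Injective p := by
      rintro ⟨a, _ | j⟩ ⟨a', _ | j'⟩ h <;> simp_all [p, hidx.eq_iff]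
    exact integral_exp_sum_inner_layer (Z := fun _ => ()) measurable_const (fun q => hθ (p q))
      (hind.precomp hp) (indepFun_const_left _ _) (fun a j => hlaw (p (a, some j)))
      (fun a => hlaw (p (a, none))) (v := fun j _ => row X j) (fun j => measurable_const) (ones k) t
  | succ l =>
    let p : κ × Option (Fin n) → Param I D := fun q =>
      q.2.elim (.bias (l + 1) hl (idx q.1)) fun j => .weight l hl (idx q.1) j
    have hp : Function.Injective p := by
      rintro ⟨a, _ | j⟩ ⟨a', _ | j'⟩ h <;> simp_all [p, hidx.eq_iff, Fin.ext_iff]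
    have hpl : ∀ q, l < (p q).layer := by
      rintro ⟨a, _ | j⟩ <;> exact Nat.lt_succ_self l
    have hv : ∀ j : Fin n, Measurable fun z : ℕ → EuclideanSpace ℝ (Fin k) =>
        (1 / (n : ℝ) ^ (1 / α)) • act φ (z j) := fun j => by
      have := (continuous_act (k := k) hφ).measurable
      fun_prop
    have key := integral_exp_sum_inner_layer (σw := σw) (σb := σb)
      (measurable_pi_lambda _ fun j =>
        measurable_network (α := α) hφ X n l (Nat.lt_of_succ_lt hl) (fun p _ => hθ p) j)
      (fun q => hθ (p q)) (hind.precomp hp)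
      (indepFun_network_of_lt_layer hφ hθ hind X n l (Nat.lt_of_succ_lt hl) hpl)
      (fun a j => hlaw (p (a, some j)))
      (fun a => hlaw (p (a, none))) hv (ones k) t
    convert key using 1
    · refine integral_congr_ae (Eventually.of_forall fun ω => ?_)
      simp only [p, Option.elim, network]
      congr 3
      refine Finset.sum_congr rfl fun a _ => ?_
      rw [Finset.sum_range, Finset.smul_sum]
      congr 2
      exact Finset.sum_congr rfl fun j _ => smul_comm _ _ _
    · refine integral_congr_ae (Eventually.of_forall fun ω => ?_)
      have hscale : |1 / (n : ℝ) ^ (1 / α)| ^ α = (n : ℝ)⁻¹ := by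
        rw [abs_of_nonneg (by positivity), one_div, Real.inv_rpow (by positivity),
          ← Real.rpow_mul (by positivity), one_div_mul_cancel hα.ne', Real.rpow_one]
      simp only [condExponent, inner_smul_left, conj_trivial, abs_mul,
        Real.mul_rpow (abs_nonneg _) (abs_nonneg _), hscale, Finset.sum_range, Finset.mul_sum]

/-! ### Convergence in distribution in a countable product -/

open Topology in
/-- Sequences of random variables converge in distribution in the product topology when their
finite initial segments do: a Lipschitz function on the product is uniformly close to a function of
finitely many coordinates. -/
theorem tendstoInDistribution_of_forall_initial {Ω Ω' E : Type*} [MeasurableSpace Ω]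
    [MeasurableSpace Ω'] {P : Measure Ω} [IsProbabilityMeasure P] {P' : Measure Ω'}
    [IsProbabilityMeasure P'] [MetricSpace E] [SecondCountableTopology E] [Nonempty E]
    [MeasurableSpace E] [BorelSpace E] {X : ℕ → Ω → ℕ → E} {Z : Ω' → ℕ → E}
    (hX : ∀ n, Measurable (X n)) (hZ : Measurable Z)
    (h : ∀ (m : ℕ) (F : (Fin m → E) → ℝ), Continuous F → (∃ M, ∀ x, |F x| ≤ M) →
      Tendsto (fun n => ∫ ω, F (fun a => X n ω a) ∂P) atTop (𝓝 (∫ ω, F (fun a => Z ω a) ∂P'))) :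
    TendstoInDistribution X atTop Z (fun _ => P) P' where
  forall_aemeasurable n := (hX n).aemeasurable
  aemeasurable_limit := hZ.aemeasurable
  tendsto := by
    let : MetricSpace (ℕ → E) := PiCountable.metricSpace
    refine tendsto_iff_forall_lipschitz_integral_tendsto.2 ?_
    rintro f ⟨C, hC⟩ ⟨L, hL⟩
    have hfm : StronglyMeasurable f := hL.continuous.stronglyMeasurable
    obtain ⟨e⟩ := ‹Nonempty E›
    let ext (m : ℕ) (x : Fin m → E) : ℕ → E := fun i => if hi : i < m then x ⟨i, hi⟩ else e
    have hext : ∀ m, Continuous (ext m) := fun m => continuous_pi fun i => by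
      by_cases hi : i < m
      · simpa only [ext, hi, dif_pos] using continuous_apply _
      · simpa only [ext, hi, dif_neg, not_false_iff] using continuous_const
    let δ (m : ℕ) : ℝ := ∑' i : ℕ, (2⁻¹ : ℝ) ^ (i + m)
    have hgeom : Summable fun i : ℕ => (2⁻¹ : ℝ) ^ i :=
      summable_geometric_of_lt_one (by norm_num) (by norm_num)
    have hδ : Tendsto δ atTop (𝓝 0) := tendsto_sum_nat_add fun i : ℕ => (2⁻¹ : ℝ) ^ i
    have hdist : ∀ m (x : ℕ → E), dist x (ext m fun a => x a) ≤ δ m := by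
      intro m x
      have hs := PiCountable.dist_summable x (ext m fun a => x a)
      rw [PiCountable.dist_eq_tsum, ← hs.sum_add_tsum_nat_add m, Finset.sum_eq_zero, zero_add]
      · exact ((summable_nat_add_iff m).2 hs).tsum_le_tsum (fun i => min_le_left _ _)
          ((summable_nat_add_iff m).2 hgeom)
      · intro i hi
        simp [ext, Finset.mem_range.1 hi]
    obtain ⟨M, hM⟩ : ∃ M, ∀ x, |f x| ≤ M := by
      refine ⟨|f fun _ => e| + C, fun x => ?_⟩
      have := hC x fun _ => e
      rw [Real.dist_eq] at this
      linarith [abs_sub_abs_le_abs_sub (f x) (f fun _ => e)]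
    have hfext : ∀ m, Measurable fun x : ℕ → E => f (ext m fun a => x a) := fun m =>
      hfm.measurable.comp ((hext m).measurable.comp (g := ext m)
        (measurable_pi_lambda (fun (x : ℕ → E) (a : Fin m) => x a) fun a =>
          measurable_pi_apply (a : ℕ)))
    have hclose : ∀ (Q : Measure (ℕ → E)) [IsProbabilityMeasure Q] (m : ℕ),
        |∫ x, f x ∂Q - ∫ x, f (ext m fun a => x a) ∂Q| ≤ L * δ m := by
      intro Q _ m
      rw [← integral_sub
        (Integrable.of_bound hfm.aestronglyMeasurable M (Eventually.of_forall fun x => hM _))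
        (Integrable.of_bound (hfext m).aestronglyMeasurable M
          (Eventually.of_forall fun x => hM _))]
      have := norm_integral_le_of_norm_le_const (μ := Q) (C := L * δ m)
        (f := fun x => f x - f (ext m fun a => x a)) (Eventually.of_forall fun x => by
          rw [← dist_eq_norm]
          exact (hL.dist_le_mul _ _).trans (by gcongr; exact hdist m _))
      simpa using this
    rw [Metric.tendsto_atTop]
    intro ε hε
    obtain ⟨m, hm⟩ : ∃ m, L * δ m < ε / 3 := by
      have := hδ.const_mul (L : ℝ)
      rw [mul_zero] at this
      exact (this.eventually (gt_mem_nhds (by positivity))).exists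
    obtain ⟨N, hN⟩ := Metric.tendsto_atTop.1
      (h m (fun x => f (ext m x)) (hL.continuous.comp (hext m)) ⟨M, fun x => hM _⟩) (ε / 3)
      (by positivity)
    refine ⟨N, fun n hn => ?_⟩
    have := Measure.isProbabilityMeasure_map (μ := P) (hX n).aemeasurable
    have := Measure.isProbabilityMeasure_map (μ := P') hZ.aemeasurable
    have h1 := hclose (P.map (X n)) m
    have h2 := hclose (P'.map Z) m
    rw [integral_map (hX n).aemeasurable (hfext m).aestronglyMeasurable] at h1
    rw [integral_map hZ.aemeasurable (hfext m).aestronglyMeasurable] at h2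
    have h3 := hN n hn
    rw [Real.dist_eq] at h3 ⊢
    simp only [ProbabilityMeasure.coe_mk]
    rw [abs_le] at h1 h2
    rw [abs_lt] at h3 ⊢
    constructor <;> linarith

/-! ### Spectral measures -/

theorem zeta_univ_le_one {k : ℕ} (h : EuclideanSpace ℝ (Fin k)) : zeta h Set.univ ≤ 1 := by
  unfold zeta
  split_ifs
  · simp [ENNReal.inv_two_add_inv_two]
  · simp

theorem lintegral_smul_zeta {k : ℕ} {α c : ℝ} (hα : 0 < α) (hc : 0 ≤ c)
    (h t : EuclideanSpace ℝ (Fin k)) :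
    ∫⁻ s : Sphere k, ENNReal.ofReal (|inner ℝ s.1 t| ^ α)
        ∂(ENNReal.ofReal (‖c • h‖ ^ α) • zeta h) =
      ENNReal.ofReal (c ^ α * |inner ℝ h t| ^ α) := by
  rw [lintegral_smul_measure]
  by_cases hh : h = 0
  · simp [hh, Real.zero_rpow hα.ne']
  have hm : Measurable fun s : Sphere k => ENNReal.ofReal (|inner ℝ s.1 t| ^ α) :=
    ((measurable_subtype_coe.inner_const).abs.pow_const _).ennreal_ofReal
  have hh' : 0 < ‖h‖ := norm_pos_iff.2 hh
  have h1 : |inner ℝ (direction h hh).1 t| ^ α = (‖h‖ ^ α)⁻¹ * |inner ℝ h t| ^ α := by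
    rw [direction, inner_smul_left, conj_trivial, abs_mul, abs_of_pos (by positivity),
      Real.mul_rpow (by positivity) (by positivity), Real.inv_rpow hh'.le]
  have h2 : |inner ℝ (-direction h hh).1 t| ^ α = (‖h‖ ^ α)⁻¹ * |inner ℝ h t| ^ α := by
    rw [← h1]
    simp [inner_neg_left]
  unfold zeta
  rw [dif_pos hh, lintegral_smul_measure, lintegral_add_measure, lintegral_dirac' _ hm,
    lintegral_dirac' _ hm, h1, h2, ← two_mul, smul_eq_mul, smul_eq_mul, ← mul_assoc 2⁻¹,
    ENNReal.inv_mul_cancel two_ne_zero ENNReal.ofNat_ne_top, one_mul,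
    ← ENNReal.ofReal_mul (by positivity), norm_smul, Real.norm_of_nonneg hc,
    Real.mul_rpow hc hh'.le]
  congr 1
  field_simp

theorem measurable_smul_zeta_act {k : ℕ} (α σ : ℝ) {φ : ℝ → ℝ} (hφ : Continuous φ) :
    Measurable fun f : EuclideanSpace ℝ (Fin k) =>
      ENNReal.ofReal (‖σ • act φ f‖ ^ α) • zeta (act φ f) := by
  have hact := (continuous_act (k := k) hφ).measurable
  refine Measure.measurable_of_measurable_coe _ fun s hs => ?_
  have hz := (Measure.measurable_coe hs).comp (measurable_zeta.comp hact)
  exact ((hact.const_smul σ).norm.pow_const α).ennreal_ofReal.mul hz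

theorem isFiniteMeasure_smul_zeta {k : ℕ} (c : ℝ) (h : EuclideanSpace ℝ (Fin k)) :
    IsFiniteMeasure (ENNReal.ofReal c • zeta h) := by
  refine ⟨?_⟩
  rw [Measure.smul_apply, smul_eq_mul]
  exact ENNReal.mul_lt_top ENNReal.ofReal_lt_top
    ((zeta_univ_le_one h).trans_lt ENNReal.one_lt_top)

theorem isFiniteMeasure_mixture {k : ℕ} {α σ : ℝ} {φ : ℝ → ℝ} (hφ : Continuous φ)
    {q : Measure (EuclideanSpace ℝ (Fin k))}
    (hq : Integrable (fun f => ‖act φ f‖ ^ α) q) : IsFiniteMeasure (mixture α σ φ q) := by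
  refine ⟨?_⟩
  rw [mixture_apply α σ hφ.measurable q MeasurableSet.univ]
  have hint : Integrable (fun f => ‖σ • act φ f‖ ^ α) q := by
    simp_rw [norm_smul, Real.mul_rpow (norm_nonneg _) (norm_nonneg _)]
    exact hq.const_mul _
  refine lt_of_le_of_lt (lintegral_mono fun f => ?_) hint.lintegral_lt_top
  exact mul_le_of_le_one_right' (zeta_univ_le_one _)

theorem integral_abs_inner_rpow_eq_toReal {k : ℕ} (α : ℝ) (Γ : Measure (Sphere k))
    (t : EuclideanSpace ℝ (Fin k)) :
    ∫ s : Sphere k, |inner ℝ s.1 t| ^ α ∂Γ =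
      (∫⁻ s : Sphere k, ENNReal.ofReal (|inner ℝ s.1 t| ^ α) ∂Γ).toReal :=
  integral_eq_lintegral_of_nonneg_ae (Eventually.of_forall fun _ => by positivity)
    ((measurable_subtype_coe.inner_const).abs.pow_const _).aestronglyMeasurable

theorem integral_spectral_zero {I k : ℕ} {α σw σb : ℝ} (hα : 0 < α) (hσw : 0 ≤ σw)
    (hσb : 0 ≤ σb) (φ : ℝ → ℝ) (X : Matrix (Fin I) (Fin k) ℝ) (t : EuclideanSpace ℝ (Fin k)) :
    ∫ s : Sphere k, |inner ℝ s.1 t| ^ α ∂(spectral α σw σb φ X 0) =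
      σb ^ α * |inner ℝ (ones k) t| ^ α + σw ^ α * ∑ j : Fin I, |inner ℝ (row X j) t| ^ α := by
  have h1 : ∀ j, ∫⁻ s : Sphere k, ENNReal.ofReal (|inner ℝ s.1 t| ^ α)
      ∂(ENNReal.ofReal (‖row X j‖ ^ α) • zeta (row X j)) =
        ENNReal.ofReal (|inner ℝ (row X j) t| ^ α) := fun j => by
    simpa using lintegral_smul_zeta hα zero_le_one (row X j) t
  rw [integral_abs_inner_rpow_eq_toReal, spectral, lintegral_add_measure,
    lintegral_smul_zeta hα hσb, lintegral_smul_measure, lintegral_finsetSum_measure,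
    Finset.sum_congr rfl fun j _ => h1 j, ← ENNReal.ofReal_sum_of_nonneg (fun j _ => by positivity),
    smul_eq_mul, ← ENNReal.ofReal_mul (by positivity), ← ENNReal.ofReal_add (by positivity)
      (by positivity), ENNReal.toReal_ofReal (by positivity)]

theorem integral_spectral_succ {I k : ℕ} {α σw σb : ℝ} (hα : 0 < α) (hσw : 0 ≤ σw)
    (hσb : 0 ≤ σb) {φ : ℝ → ℝ} (hφ : Continuous φ) (X : Matrix (Fin I) (Fin k) ℝ) (l : ℕ)
    (t : EuclideanSpace ℝ (Fin k))
    (hint : Integrable (fun f => |inner ℝ (act φ f) t| ^ α)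
      (stableLaw α (spectral α σw σb φ X l))) :
    ∫ s : Sphere k, |inner ℝ s.1 t| ^ α ∂(spectral α σw σb φ X (l + 1)) =
      σb ^ α * |inner ℝ (ones k) t| ^ α +
        σw ^ α * ∫ f, |inner ℝ (act φ f) t| ^ α ∂(stableLaw α (spectral α σw σb φ X l)) := by
  have hm : Measurable fun s : Sphere k => ENNReal.ofReal (|inner ℝ s.1 t| ^ α) :=
    ((measurable_subtype_coe.inner_const).abs.pow_const _).ennreal_ofReal
  rw [integral_abs_inner_rpow_eq_toReal, spectral, lintegral_add_measure,
    lintegral_smul_zeta hα hσb, mixture, Measure.lintegral_bind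
      (measurable_smul_zeta_act α σw hφ).aemeasurable hm.aemeasurable]
  simp_rw [lintegral_smul_zeta hα hσw]
  rw [← ofReal_integral_eq_lintegral_ofReal (hint.const_mul _)
    (Eventually.of_forall fun _ => by positivity), integral_const_mul,
    ← ENNReal.ofReal_add (by positivity) (by positivity), ENNReal.toReal_ofReal (by positivity)]

theorem integral_abs_inner_rpow_le {k : ℕ} {α : ℝ} (hα : 0 < α) (Γ : Measure (Sphere k))
    [IsFiniteMeasure Γ] (t : EuclideanSpace ℝ (Fin k)) :
    ∫ s : Sphere k, |inner ℝ s.1 t| ^ α ∂Γ ≤ Γ.real Set.univ * ‖t‖ ^ α := by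
  calc ∫ s : Sphere k, |inner ℝ s.1 t| ^ α ∂Γ ≤ ∫ _ : Sphere k, ‖t‖ ^ α ∂Γ := by
        refine integral_mono_of_nonneg (Eventually.of_forall fun _ => by positivity)
          (integrable_const _) (Eventually.of_forall fun s => ?_)
        have h1 : |inner ℝ s.1 t| ≤ ‖t‖ := by
          simpa using abs_real_inner_le_norm s.1 t
        beta_reduce
        gcongr
    _ = _ := by simp

/-- Stable characteristic functions satisfy the bound that controls the moments. -/
theorem IsStable.norm_one_sub_charFun_le {k : ℕ} {α : ℝ} (hα : 0 < α) {Γ : Measure (Sphere k)}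
    {μ : Measure (EuclideanSpace ℝ (Fin k))} (hμ : IsStable α Γ μ)
    (t : EuclideanSpace ℝ (Fin k)) : ‖1 - charFun μ t‖ ≤ Γ.real Set.univ * ‖t‖ ^ α := by
  have := hμ.isFiniteMeasure
  have h0 : 0 ≤ ∫ s : Sphere k, |inner ℝ s.1 t| ^ α ∂Γ := integral_nonneg fun _ => by positivity
  rw [hμ.charFun_eq, ← Complex.ofReal_one, ← Complex.ofReal_sub, Complex.norm_real,
    Real.norm_of_nonneg (sub_nonneg.2 (Real.exp_le_one_iff.2 (neg_nonpos.2 h0)))]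
  refine le_trans ?_ (integral_abs_inner_rpow_le hα Γ t)
  linarith [Real.add_one_le_exp (-∫ s : Sphere k, |inner ℝ s.1 t| ^ α ∂Γ)]

/-! ### Convergence of the layers -/

/-- The induction hypothesis on a layer: the conditional exponents of its units converge in mean to
the exponent of the limit law, and their means are bounded uniformly in the width. -/
structure LayerConverges {Ω : Type*} [MeasurableSpace Ω] (P : Measure Ω) {I D k : ℕ}
    (α σw σb : ℝ) (φ : ℝ → ℝ) (θ : Param I D → Ω → ℝ) (X : Matrix (Fin I) (Fin k) ℝ)
    (l : ℕ) (hl : l < D) : Prop where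
  isFiniteMeasure : IsFiniteMeasure (spectral α σw σb φ X l)
  bound : ∃ C, 0 ≤ C ∧ ∀ n t,
    Integrable (fun ω => condExponent α σw σb φ (fun p => θ p ω) X n l hl t) P ∧
      ∫ ω, condExponent α σw σb φ (fun p => θ p ω) X n l hl t ∂P ≤ C * ‖t‖ ^ α
  tendsto : ∀ t, Tendsto (fun n => ∫ ω, |condExponent α σw σb φ (fun p => θ p ω) X n l hl t -
    ∫ s : Sphere k, |inner ℝ s.1 t| ^ α ∂(spectral α σw σb φ X l)| ∂P) atTop (nhds 0)

theorem abs_exp_neg_sub_exp_neg_le {x y : ℝ} (hx : 0 ≤ x) (hy : 0 ≤ y) :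
    |Real.exp (-x) - Real.exp (-y)| ≤ |x - y| := by
  have key : ∀ {u v : ℝ}, 0 ≤ u → u ≤ v → Real.exp (-u) - Real.exp (-v) ≤ v - u := by
    intro u v hu huv
    have h1 : Real.exp (-v) = Real.exp (-u) * Real.exp (-(v - u)) := by
      rw [← Real.exp_add]
      ring_nf
    have h2 : Real.exp (-u) ≤ 1 := Real.exp_le_one_iff.2 (by linarith)
    have h3 := Real.add_one_le_exp (-(v - u))
    have h4 := Real.exp_pos (-u)
    nlinarith
  rcases le_total x y with h | h
  · rw [abs_of_nonneg (sub_nonneg.2 (Real.exp_le_exp.2 (neg_le_neg h))), abs_sub_comm,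
      abs_of_nonneg (sub_nonneg.2 h)]
    exact key hx h
  · rw [abs_sub_comm, abs_of_nonneg (sub_nonneg.2 (Real.exp_le_exp.2 (neg_le_neg h))),
      abs_of_nonneg (sub_nonneg.2 h)]
    exact key hy h

section Layer

variable {Ω : Type*} [MeasurableSpace Ω] {P : Measure Ω} {I D k : ℕ}
  {α σw σb : ℝ} {φ : ℝ → ℝ} {θ : Param I D → Ω → ℝ} {X : Matrix (Fin I) (Fin k) ℝ}
  {l : ℕ} {hl : l < D} {κ : Type*}

variable (P α φ θ X l hl) in
/-- The joint law of the units `idx a` of layer `l`. It lives on an `ℓ²` product of Euclidean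
spaces, where characteristic functions are available. -/
noncomputable def unitsLaw (n : ℕ) (idx : κ → ℕ) :
    Measure (PiLp 2 fun _ : κ => EuclideanSpace ℝ (Fin k)) :=
  P.map fun ω => WithLp.toLp 2 fun a => network α φ (fun p => θ p ω) X n l hl (idx a)

theorem measurable_units (hφ : Continuous φ) (hθ : ∀ p, Measurable (θ p)) (n : ℕ) (idx : κ → ℕ) :
    Measurable fun ω => (WithLp.toLp 2 fun a => network α φ (fun p => θ p ω) X n l hl (idx a) :
      PiLp 2 fun _ : κ => EuclideanSpace ℝ (Fin k)) :=
  (WithLp.measurable_toLp 2 _).comp (measurable_pi_lambda _ fun a =>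
    measurable_network hφ X n l hl (fun p _ => hθ p) (idx a))

theorem integral_unitsLaw [Fintype κ] (hφ : Continuous φ) (hθ : ∀ p, Measurable (θ p)) (n : ℕ)
    (idx : κ → ℕ)
    {F : (κ → EuclideanSpace ℝ (Fin k)) → ℝ} (hF : Continuous F) :
    ∫ x, F (WithLp.ofLp x) ∂(unitsLaw P α φ θ X l hl n idx) =
      ∫ ω, F (fun a => network α φ (fun p => θ p ω) X n l hl (idx a)) ∂P := by
  rw [unitsLaw, integral_map (measurable_units hφ hθ n idx).aemeasurable]
  exact (hF.comp (PiLp.continuous_ofLp 2 _)).aestronglyMeasurable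

variable [IsProbabilityMeasure P]

theorem isProbabilityMeasure_unitsLaw (hφ : Continuous φ) (hθ : ∀ p, Measurable (θ p)) (n : ℕ)
    (idx : κ → ℕ) : IsProbabilityMeasure (unitsLaw P α φ θ X l hl n idx) :=
  Measure.isProbabilityMeasure_map (measurable_units hφ hθ n idx).aemeasurable

theorem charFun_unitsLaw [Fintype κ] (hα : 0 < α) (hφ : Continuous φ)
    (hθ : ∀ p, Measurable (θ p))
    (hlaw : ∀ p, IsStableReal α (p.scale σw σb) (P.map (θ p))) (hind : iIndepFun θ P) (n : ℕ)
    {idx : κ → ℕ} (hidx : Function.Injective idx)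
    (t : PiLp 2 fun _ : κ => EuclideanSpace ℝ (Fin k)) :
    charFun (unitsLaw P α φ θ X l hl n idx) t =
      ((∫ ω, Real.exp (-∑ a, condExponent α σw σb φ (fun p => θ p ω) X n l hl (t a)) ∂P : ℝ) :
        ℂ) := by
  rw [← integral_complex_ofReal,
    ← integral_exp_sum_inner_network hα hθ hlaw hind hφ X n l hl hidx fun a => t a, charFun_apply,
    unitsLaw, integral_map (measurable_units hφ hθ n idx).aemeasurable (by fun_prop)]
  simp only [PiLp.inner_apply]

/-- The units of a layer are exchangeable. -/
theorem unitsLaw_eq [Fintype κ] (hα : 0 < α) (hφ : Continuous φ)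
    (hθ : ∀ p, Measurable (θ p))
    (hlaw : ∀ p, IsStableReal α (p.scale σw σb) (P.map (θ p))) (hind : iIndepFun θ P) (n : ℕ)
    {idx idx' : κ → ℕ} (hidx : Function.Injective idx) (hidx' : Function.Injective idx') :
    unitsLaw P α φ θ X l hl n idx = unitsLaw P α φ θ X l hl n idx' := by
  have := isProbabilityMeasure_unitsLaw (P := P) (α := α) (X := X) (hl := hl) hφ hθ n idx
  have := isProbabilityMeasure_unitsLaw (P := P) (α := α) (X := X) (hl := hl) hφ hθ n idx'
  refine Measure.ext_of_charFun (funext fun t => ?_)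
  rw [charFun_unitsLaw hα hφ hθ hlaw hind n hidx, charFun_unitsLaw hα hφ hθ hlaw hind n hidx']

theorem charFun_map_network (hα : 0 < α) (hφ : Continuous φ) (hθ : ∀ p, Measurable (θ p))
    (hlaw : ∀ p, IsStableReal α (p.scale σw σb) (P.map (θ p))) (hind : iIndepFun θ P) (n j : ℕ)
    (t : EuclideanSpace ℝ (Fin k)) :
    charFun (P.map fun ω => network α φ (fun p => θ p ω) X n l hl j) t =
      ((∫ ω, Real.exp (-condExponent α σw σb φ (fun p => θ p ω) X n l hl t) ∂P : ℝ) : ℂ) := by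
  have h := integral_exp_sum_inner_network (κ := Unit) hα hθ hlaw hind hφ X n l hl
    (idx := fun _ => j) (fun _ _ _ => rfl) fun _ => t
  simp only [Finset.univ_unique, Finset.sum_singleton] at h
  rw [← integral_complex_ofReal, ← h, charFun_apply, integral_map
    (measurable_network hφ X n l hl (fun p _ => hθ p) j).aemeasurable (by fun_prop)]

theorem LayerConverges.tendsto_integral_exp_neg_sum
    [Fintype κ] (h : LayerConverges P α σw σb φ θ X l hl) (hσw : 0 ≤ σw) (hσb : 0 ≤ σb)
    (hφ : Continuous φ) (hθ : ∀ p, Measurable (θ p)) (t : κ → EuclideanSpace ℝ (Fin k)) :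
    Tendsto (fun n => ∫ ω, Real.exp (-∑ a,
        condExponent α σw σb φ (fun p => θ p ω) X n l hl (t a)) ∂P) atTop
      (nhds (Real.exp (-∑ a, ∫ s : Sphere k, |inner ℝ s.1 (t a)| ^ α
        ∂(spectral α σw σb φ X l)))) := by
  set Ψ : EuclideanSpace ℝ (Fin k) → ℝ := fun t =>
    ∫ s : Sphere k, |inner ℝ s.1 t| ^ α ∂(spectral α σw σb φ X l) with hΨ
  set V : ℕ → EuclideanSpace ℝ (Fin k) → Ω → ℝ := fun n t ω =>
    condExponent α σw σb φ (fun p => θ p ω) X n l hl t with hV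
  have hV0 : ∀ n t ω, 0 ≤ V n t ω := fun n t ω => condExponent_nonneg hσw hσb _ _ _ _ _ _ _
  have hΨ0 : ∀ t, 0 ≤ Ψ t := fun t => integral_nonneg fun _ => by positivity
  have hVm : ∀ n t, Measurable (V n t) := fun n t => measurable_condExponent hφ hθ X n l hl t
  obtain ⟨C, -, hC⟩ := h.bound
  have hlim : Tendsto (fun n => ∑ a, ∫ ω, |V n (t a) ω - Ψ (t a)| ∂P) atTop (nhds 0) := by
    simpa using tendsto_finsetSum Finset.univ fun a _ => h.tendsto (t a)
  rw [tendsto_iff_dist_tendsto_zero]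
  refine squeeze_zero (fun _ => dist_nonneg) (fun n => ?_) hlim
  have hint : ∀ a, Integrable (fun ω => |V n (t a) ω - Ψ (t a)|) P := fun a =>
    ((hC n (t a)).1.sub (integrable_const _)).abs
  have hexp : Integrable (fun ω => Real.exp (-∑ a, V n (t a) ω)) P := by
    refine Integrable.of_bound ?_ 1 (Eventually.of_forall fun ω => ?_)
    · exact (Real.measurable_exp.comp
        (Finset.measurable_fun_sum _ fun a _ => hVm n (t a)).neg).aestronglyMeasurable
    · rw [Real.norm_of_nonneg (Real.exp_pos _).le]
      exact Real.exp_le_one_iff.2 (neg_nonpos.2 (Finset.sum_nonneg fun a _ => hV0 _ _ _))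
  calc dist (∫ ω, Real.exp (-∑ a, V n (t a) ω) ∂P) (Real.exp (-∑ a, Ψ (t a)))
      = |∫ ω, (Real.exp (-∑ a, V n (t a) ω) - Real.exp (-∑ a, Ψ (t a))) ∂P| := by
        rw [integral_sub hexp (integrable_const _), Real.dist_eq]
        simp
    _ ≤ ∫ ω, |Real.exp (-∑ a, V n (t a) ω) - Real.exp (-∑ a, Ψ (t a))| ∂P :=
        abs_integral_le_integral_abs
    _ ≤ ∫ ω, ∑ a, |V n (t a) ω - Ψ (t a)| ∂P := by
        refine integral_mono (hexp.sub (integrable_const _)).abs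
          (integrable_finsetSum _ fun a _ => hint a) fun ω => ?_
        refine (abs_exp_neg_sub_exp_neg_le (Finset.sum_nonneg fun a _ => hV0 _ _ _)
          (Finset.sum_nonneg fun a _ => hΨ0 _)).trans ?_
        rw [← Finset.sum_sub_distrib]
        exact Finset.abs_sum_le_sum_abs _ _
    _ = _ := integral_finsetSum _ fun a _ => hint a

/-- The limit law of a layer exists, as the limit of the laws of its units. -/
theorem LayerConverges.isStable (h : LayerConverges P α σw σb φ θ X l hl) (hα : 0 < α)
    (hσw : 0 ≤ σw) (hσb : 0 ≤ σb) (hφ : Continuous φ) (hθ : ∀ p, Measurable (θ p))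
    (hlaw : ∀ p, IsStableReal α (p.scale σw σb) (P.map (θ p))) (hind : iIndepFun θ P) :
    IsStable α (spectral α σw σb φ X l) (stableLaw α (spectral α σw σb φ X l)) := by
  have := h.isFiniteMeasure
  set Γ := spectral α σw σb φ X l with hΓ
  let μ : ℕ → ProbabilityMeasure (EuclideanSpace ℝ (Fin k)) := fun n =>
    ⟨P.map fun ω => network α φ (fun p => θ p ω) X n l hl 0, Measure.isProbabilityMeasure_map
      (measurable_network hφ X n l hl (fun p _ => hθ p) 0).aemeasurable⟩
  have hcont : ContinuousAt (fun t : EuclideanSpace ℝ (Fin k) =>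
      ((Real.exp (-∫ s : Sphere k, |inner ℝ s.1 t| ^ α ∂Γ) : ℝ) : ℂ)) 0 := by
    refine Complex.continuous_ofReal.continuousAt.comp
      (Real.continuous_exp.continuousAt.comp (ContinuousAt.neg ?_))
    have h0 : ∫ s : Sphere k, |inner ℝ s.1 (0 : EuclideanSpace ℝ (Fin k))| ^ α ∂Γ = 0 := by
      simp [Real.zero_rpow hα.ne']
    rw [ContinuousAt, h0]
    refine squeeze_zero (fun t => integral_nonneg fun _ => by positivity)
      (fun t => integral_abs_inner_rpow_le hα Γ t) ?_
    have hc : Continuous fun t : EuclideanSpace ℝ (Fin k) => Γ.real Set.univ * ‖t‖ ^ α :=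
      continuous_const.mul (continuous_norm.rpow_const fun _ => Or.inr hα.le)
    simpa [Real.zero_rpow hα.ne'] using hc.tendsto 0
  obtain ⟨ν, hν⟩ := exists_charFun_eq_of_tendsto (μ := μ) hcont fun t => by
    have := h.tendsto_integral_exp_neg_sum hσw hσb hφ hθ (κ := Unit) fun _ => t
    simp only [Finset.univ_unique, Finset.sum_singleton] at this
    refine ((Complex.continuous_ofReal.tendsto _).comp this).congr fun n => ?_
    exact (charFun_map_network hα hφ hθ hlaw hind n 0 t).symm
  have hst : IsStable α Γ (ν : Measure (EuclideanSpace ℝ (Fin k))) := ⟨this, ν.2, hν⟩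
  exact hst.eq_stableLaw ▸ hst

/-- Distinct units of a layer are asymptotically independent with the limit law. -/
theorem LayerConverges.tendsto_integral_units [Fintype κ]
    (h : LayerConverges P α σw σb φ θ X l hl) (hα : 0 < α) (hσw : 0 ≤ σw) (hσb : 0 ≤ σb)
    (hφ : Continuous φ) (hθ : ∀ p, Measurable (θ p))
    (hlaw : ∀ p, IsStableReal α (p.scale σw σb) (P.map (θ p))) (hind : iIndepFun θ P)
    {idx : κ → ℕ} (hidx : Function.Injective idx) {F : (κ → EuclideanSpace ℝ (Fin k)) → ℝ}
    (hF : Continuous F) (hFb : ∃ M, ∀ x, |F x| ≤ M) :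
    Tendsto (fun n => ∫ ω, F (fun a => network α φ (fun p => θ p ω) X n l hl (idx a)) ∂P) atTop
      (nhds (∫ x, F x ∂(Measure.pi fun _ : κ => stableLaw α (spectral α σw σb φ X l)))) := by
  have hst := h.isStable hα hσw hσb hφ hθ hlaw hind
  set q := stableLaw α (spectral α σw σb φ X l) with hq
  have := hst.isProbabilityMeasure
  let μ : ℕ → ProbabilityMeasure (PiLp 2 fun _ : κ => EuclideanSpace ℝ (Fin k)) := fun n =>
    ⟨unitsLaw P α φ θ X l hl n idx, isProbabilityMeasure_unitsLaw hφ hθ n idx⟩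
  have hmeas : Measurable (WithLp.toLp 2 : (κ → EuclideanSpace ℝ (Fin k)) → _) :=
    WithLp.measurable_toLp 2 _
  let ν : ProbabilityMeasure (PiLp 2 fun _ : κ => EuclideanSpace ℝ (Fin k)) :=
    ⟨(Measure.pi fun _ : κ => q).map (WithLp.toLp 2),
      Measure.isProbabilityMeasure_map hmeas.aemeasurable⟩
  have hlim : Tendsto μ atTop (nhds ν) := by
    refine ProbabilityMeasure.tendsto_of_tendsto_charFun fun t => ?_
    have h1 := h.tendsto_integral_exp_neg_sum hσw hσb hφ hθ fun a => t a
    have h2 : charFun (ν : Measure (PiLp 2 fun _ : κ => EuclideanSpace ℝ (Fin k))) t =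
        ((Real.exp (-∑ a, ∫ s : Sphere k, |inner ℝ s.1 (t a)| ^ α
          ∂(spectral α σw σb φ X l)) : ℝ) : ℂ) := by
      change charFun ((Measure.pi fun _ : κ => q).map (WithLp.toLp 2)) t = _
      rw [charFun_pi]
      simp_rw [hst.charFun_eq]
      rw [← Complex.ofReal_prod, ← Real.exp_sum, Finset.sum_neg_distrib]
    rw [h2]
    exact ((Complex.continuous_ofReal.tendsto _).comp h1).congr fun n =>
      (charFun_unitsLaw hα hφ hθ hlaw hind n hidx t).symm
  obtain ⟨M, hM⟩ := hFb
  have hFc : Continuous fun x : PiLp 2 fun _ : κ => EuclideanSpace ℝ (Fin k) => F (WithLp.ofLp x) :=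
    hF.comp (PiLp.continuous_ofLp 2 _)
  have h3 := ProbabilityMeasure.tendsto_iff_forall_integral_tendsto.1 hlim
    (BoundedContinuousFunction.ofNormedAddCommGroup _ hFc M fun x => hM _)
  have h4 : ∫ x, F (WithLp.ofLp x) ∂((Measure.pi fun _ : κ => q).map (WithLp.toLp 2)) =
      ∫ x, F x ∂(Measure.pi fun _ : κ => q) := by
    rw [integral_map hmeas.aemeasurable hFc.aestronglyMeasurable]
  rw [← h4]
  refine h3.congr fun n => ?_
  exact integral_unitsLaw hφ hθ n idx hF

end Layer

/-! ### The induction over the layers -/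

/-- The summands `|⟨φ ∘ y, t⟩| ^ α` have uniformly bounded moments of an order `s > 1` under all
laws with a given bound on the characteristic function. Any `s > 1` with `β s < 1` does. -/
theorem exists_integral_abs_inner_act_rpow_le (k : ℕ) {α : ℝ} (hα : 0 < α) {C : ℝ} (hC0 : 0 ≤ C)
    {φ : ℝ → ℝ} (hφ : Continuous φ) {a b β : ℝ} (ha : 0 ≤ a) (hb : 0 ≤ b) (hβ0 : 0 < β)
    (hβ1 : β < 1) (hgrowth : ∀ s : ℝ, |φ s| ≤ a + b * |s| ^ β) :
    ∃ s K₁ K : ℝ, 1 < s ∧ 0 ≤ K₁ ∧ ∀ μ : Measure (EuclideanSpace ℝ (Fin k)),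
      IsProbabilityMeasure μ → (∀ t, ‖1 - charFun μ t‖ ≤ C * ‖t‖ ^ α) →
      Integrable (fun y => ‖act φ y‖ ^ α) μ ∧ ∀ t,
        (Integrable (fun y => |inner ℝ (act φ y) t| ^ α) μ ∧
          ∫ y, |inner ℝ (act φ y) t| ^ α ∂μ ≤ K₁ * ‖t‖ ^ α) ∧
        Integrable (fun y => (|inner ℝ (act φ y) t| ^ α) ^ s) μ ∧
          ∫ y, (|inner ℝ (act φ y) t| ^ α) ^ s ∂μ ≤ K * ‖t‖ ^ (α * s) := by
  have hact := continuous_act (k := k) hφ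
  set s : ℝ := 2 / (1 + β) with hs
  have hs1 : 1 < s := by rw [hs, lt_div_iff₀ (by linarith)]; linarith
  have hβs : β * (α * s) < α := by
    have : β * s < 1 := by rw [hs, mul_div_assoc', div_lt_one (by linarith)]; linarith
    nlinarith
  obtain ⟨K₁, hK₁0, hK₁⟩ := exists_integral_norm_act_rpow_le k (α := α) hC0 hφ ha hb hβ0 hgrowth
    hα (by nlinarith)
  obtain ⟨K, hK0, hK⟩ := exists_integral_norm_act_rpow_le k (α := α) hC0 hφ ha hb hβ0 hgrowth
    (q := α * s) (by positivity) hβs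
  let g : EuclideanSpace ℝ (Fin k) → EuclideanSpace ℝ (Fin k) → ℝ := fun t y =>
    |inner ℝ (act φ y) t| ^ α
  have hg : ∀ t, Continuous (g t) := fun t =>
    (hact.inner continuous_const).abs.rpow_const fun _ => Or.inr hα.le
  have hg0 : ∀ t y, 0 ≤ g t y := fun t y => by positivity
  have hgle : ∀ t y, g t y ≤ ‖act φ y‖ ^ α * ‖t‖ ^ α := fun t y => by
    rw [← Real.mul_rpow (norm_nonneg _) (norm_nonneg _)]
    exact Real.rpow_le_rpow (abs_nonneg _) (abs_real_inner_le_norm _ _) hα.le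
  have hgsle : ∀ t y, g t y ^ s ≤ ‖act φ y‖ ^ (α * s) * ‖t‖ ^ (α * s) := fun t y => by
    refine (Real.rpow_le_rpow (hg0 t y) (hgle t y) (by linarith)).trans_eq ?_
    rw [Real.mul_rpow (by positivity) (by positivity), ← Real.rpow_mul (norm_nonneg _),
      ← Real.rpow_mul (norm_nonneg _)]
  refine ⟨s, K₁, K, hs1, hK₁0, fun μ hμ hμC => ?_⟩
  obtain ⟨h1, h2⟩ := hK₁ μ hμ hμC
  obtain ⟨h3, h4⟩ := hK μ hμ hμC
  refine ⟨h1, fun t => ⟨⟨?_, ?_⟩, ?_, ?_⟩⟩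
  · refine (h1.mul_const (‖t‖ ^ α)).mono' (hg t).measurable.aestronglyMeasurable
      (Eventually.of_forall fun y => ?_)
    rw [Real.norm_of_nonneg (hg0 t y)]
    exact hgle t y
  · refine (integral_mono_of_nonneg (Eventually.of_forall (hg0 t)) (h1.mul_const (‖t‖ ^ α))
      (Eventually.of_forall (hgle t))).trans ?_
    rw [integral_mul_const]
    gcongr
  · refine (h3.mul_const (‖t‖ ^ (α * s))).mono' ((hg t).measurable.pow_const _).aestronglyMeasurable
      (Eventually.of_forall fun y => ?_)
    rw [Real.norm_of_nonneg (Real.rpow_nonneg (hg0 t y) _)]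
    exact hgsle t y
  · refine (integral_mono_of_nonneg
      (Eventually.of_forall fun y => Real.rpow_nonneg (hg0 t y) _)
      (h3.mul_const (‖t‖ ^ (α * s))) (Eventually.of_forall (hgsle t))).trans ?_
    rw [integral_mul_const]
    gcongr

section Induction

variable {Ω : Type*} [MeasurableSpace Ω] {P : Measure Ω} [IsProbabilityMeasure P] {I D k : ℕ}
  {α σw σb : ℝ} {φ : ℝ → ℝ} {θ : Param I D → Ω → ℝ} {X : Matrix (Fin I) (Fin k) ℝ}

theorem layerConverges_zero (hα : 0 < α) (hσw : 0 ≤ σw) (hσb : 0 ≤ σb) (hl : 0 < D) :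
    LayerConverges P α σw σb φ θ X 0 hl where
  isFiniteMeasure := by
    have h1 := isFiniteMeasure_smul_zeta (‖σb • ones k‖ ^ α) (ones k)
    have := fun j => isFiniteMeasure_smul_zeta (‖row X j‖ ^ α) (row X j)
    unfold spectral
    refine @isFiniteMeasureAdd _ _ _ _ ?_ ?_
    · exact h1
    · refine ⟨?_⟩
      rw [Measure.smul_apply, smul_eq_mul]
      exact ENNReal.mul_lt_top ENNReal.ofReal_lt_top (measure_lt_top _ _)
  bound := by
    refine ⟨σb ^ α * ‖ones k‖ ^ α + σw ^ α * ∑ j : Fin I, ‖row X j‖ ^ α, by positivity,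
      fun n t => ⟨integrable_const _, ?_⟩⟩
    simp only [condExponent, integral_const, probReal_univ, one_smul]
    have h1 : ∀ v : EuclideanSpace ℝ (Fin k), |inner ℝ v t| ^ α ≤ ‖v‖ ^ α * ‖t‖ ^ α := fun v => by
      rw [← Real.mul_rpow (norm_nonneg _) (norm_nonneg _)]
      gcongr
      exact abs_real_inner_le_norm v t
    rw [add_mul, mul_assoc, mul_assoc, Finset.sum_mul]
    gcongr with j
    · exact h1 _
    · exact h1 _
  tendsto t := by
    rw [integral_spectral_zero hα hσw hσb]
    simp [condExponent]

/-- The bound on the conditional exponents controls the moments of the units. -/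
theorem norm_one_sub_charFun_network_le {l : ℕ} {hl : l < D} {C : ℝ}
    (hC : ∀ n t, Integrable (fun ω => condExponent α σw σb φ (fun p => θ p ω) X n l hl t) P ∧
      ∫ ω, condExponent α σw σb φ (fun p => θ p ω) X n l hl t ∂P ≤ C * ‖t‖ ^ α)
    (hα : 0 < α) (hσw : 0 ≤ σw) (hσb : 0 ≤ σb) (hφ : Continuous φ) (hθ : ∀ p, Measurable (θ p))
    (hlaw : ∀ p, IsStableReal α (p.scale σw σb) (P.map (θ p))) (hind : iIndepFun θ P)
    (n j : ℕ) (t : EuclideanSpace ℝ (Fin k)) :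
    ‖1 - charFun (P.map fun ω => network α φ (fun p => θ p ω) X n l hl j) t‖ ≤ C * ‖t‖ ^ α := by
  have hV0 : ∀ ω, 0 ≤ condExponent α σw σb φ (fun p => θ p ω) X n l hl t := fun ω =>
    condExponent_nonneg hσw hσb _ _ _ _ _ _ _
  have hle : ∀ ω, Real.exp (-condExponent α σw σb φ (fun p => θ p ω) X n l hl t) ≤ 1 := fun ω =>
    Real.exp_le_one_iff.2 (neg_nonpos.2 (hV0 ω))
  have hexp : Integrable (fun ω => Real.exp (-condExponent α σw σb φ (fun p => θ p ω) X n l hl t))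
      P := by
    refine Integrable.of_bound (Real.measurable_exp.comp
      (measurable_condExponent hφ hθ X n l hl t).neg).aestronglyMeasurable 1
      (Eventually.of_forall fun ω => ?_)
    rw [Real.norm_of_nonneg (Real.exp_pos _).le]
    exact hle ω
  rw [charFun_map_network hα hφ hθ hlaw hind, ← Complex.ofReal_one, ← Complex.ofReal_sub,
    Complex.norm_real]
  have h1 : (1 : ℝ) - ∫ ω, Real.exp (-condExponent α σw σb φ (fun p => θ p ω) X n l hl t) ∂P =
      ∫ ω, (1 - Real.exp (-condExponent α σw σb φ (fun p => θ p ω) X n l hl t)) ∂P := by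
    rw [integral_sub (integrable_const _) hexp]
    simp
  rw [h1, Real.norm_of_nonneg (integral_nonneg fun ω => sub_nonneg.2 (hle ω))]
  refine le_trans (integral_mono ((integrable_const 1).sub hexp) (hC n t).1 fun ω => ?_) (hC n t).2
  have := Real.add_one_le_exp (-condExponent α σw σb φ (fun p => θ p ω) X n l hl t)
  beta_reduce
  linarith

/-- Pairs of distinct units are asymptotically uncorrelated under bounded continuous functions,
uniformly over the pairs. -/
theorem LayerConverges.exists_tendsto_integral_mul_le {l : ℕ} {hl : l < D}
    (h : LayerConverges P α σw σb φ θ X l hl) (hα : 0 < α) (hσw : 0 ≤ σw) (hσb : 0 ≤ σb)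
    (hφ : Continuous φ) (hθ : ∀ p, Measurable (θ p))
    (hlaw : ∀ p, IsStableReal α (p.scale σw σb) (P.map (θ p))) (hind : iIndepFun θ P)
    {f : EuclideanSpace ℝ (Fin k) → ℝ} (hf : Continuous f) (hfb : ∃ M, ∀ y, |f y| ≤ M) :
    ∃ ρ : ℕ → ℝ, Tendsto ρ atTop (nhds 0) ∧ ∀ n j j', j ≠ j' →
      ∫ ω, (f (network α φ (fun p => θ p ω) X n l hl j) -
          ∫ y, f y ∂(stableLaw α (spectral α σw σb φ X l))) *
        (f (network α φ (fun p => θ p ω) X n l hl j') -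
          ∫ y, f y ∂(stableLaw α (spectral α σw σb φ X l))) ∂P ≤ ρ n := by
  have hst := h.isStable hα hσw hσb hφ hθ hlaw hind
  set q := stableLaw α (spectral α σw σb φ X l) with hq
  have := hst.isProbabilityMeasure
  set c := ∫ y, f y ∂q with hc
  obtain ⟨M, hM⟩ := hfb
  let F : (Fin 2 → EuclideanSpace ℝ (Fin k)) → ℝ := fun x => (f (x 0) - c) * (f (x 1) - c)
  have hF : Continuous F := by fun_prop
  have hFb : ∀ x, |F x| ≤ (M + |c|) * (M + |c|) := fun x => by
    have h1 : ∀ y, |f y - c| ≤ M + |c| := fun y => (abs_sub _ _).trans (by gcongr; exact hM y)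
    rw [abs_mul]
    exact mul_le_mul (h1 _) (h1 _) (abs_nonneg _) ((abs_nonneg _).trans (h1 0))
  have hFlim : ∫ x, F x ∂(Measure.pi fun _ : Fin 2 => q) = 0 := by
    have h1 := integral_fintype_prod_eq_prod (𝕜 := ℝ)
      (fun (_ : Fin 2) (y : EuclideanSpace ℝ (Fin k)) => f y - c) (μ := fun _ => q)
    have h2 : ∫ y, (f y - c) ∂q = 0 := by
      rw [integral_sub (Integrable.of_bound hf.measurable.aestronglyMeasurable M
        (Eventually.of_forall hM)) (integrable_const _)]
      simp [hc]
    simp only [Fin.prod_univ_two, h2, mul_zero] at h1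
    exact h1
  have hidx : ∀ {j j' : ℕ}, j ≠ j' → Function.Injective ![j, j'] := by
    intro j j' hjj' a b hab
    fin_cases a <;> fin_cases b <;> simp_all [eq_comm]
  refine ⟨fun n => ∫ ω, F fun a => network α φ (fun p => θ p ω) X n l hl (![0, 1] a) ∂P, ?_,
    fun n j j' hjj' => le_of_eq ?_⟩
  · have h1 := h.tendsto_integral_units hα hσw hσb hφ hθ hlaw hind (hidx zero_ne_one) hF ⟨_, hFb⟩
    rwa [hFlim] at h1
  · have h1 := integral_unitsLaw (P := P) (α := α) (X := X) (hl := hl) hφ hθ n ![j, j'] hF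
    rw [unitsLaw_eq hα hφ hθ hlaw hind n (hidx hjj') (hidx zero_ne_one),
      integral_unitsLaw hφ hθ n _ hF] at h1
    exact h1.symm

/-- The induction step: by the law of large numbers for the units of layer `l`, the conditional
exponents of layer `l + 1` converge. -/
theorem LayerConverges.succ {l : ℕ} {hl : l + 1 < D}
    (h : LayerConverges P α σw σb φ θ X l (Nat.lt_of_succ_lt hl)) (hα : 0 < α) (hσw : 0 ≤ σw)
    (hσb : 0 ≤ σb) (hθ : ∀ p, Measurable (θ p))
    (hlaw : ∀ p, IsStableReal α (p.scale σw σb) (P.map (θ p))) (hind : iIndepFun θ P)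
    (hφ : Continuous φ) {a b β : ℝ} (ha : 0 ≤ a) (hb : 0 ≤ b) (hβ0 : 0 < β) (hβ1 : β < 1)
    (hgrowth : ∀ s : ℝ, |φ s| ≤ a + b * |s| ^ β) :
    LayerConverges P α σw σb φ θ X (l + 1) hl := by
  have hst := h.isStable hα hσw hσb hφ hθ hlaw hind
  obtain ⟨C, hC0, hC⟩ := h.bound
  set Γ := spectral α σw σb φ X l with hΓ
  set q := stableLaw α Γ with hq
  have := hst.isProbabilityMeasure
  let Y : ℕ → ℕ → Ω → EuclideanSpace ℝ (Fin k) := fun n j ω =>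
    network α φ (fun p => θ p ω) X n l (Nat.lt_of_succ_lt hl) j
  have hY : ∀ n j, Measurable (Y n j) := fun n j =>
    measurable_network hφ X n l _ (fun p _ => hθ p) j
  have hYp : ∀ n j, IsProbabilityMeasure (P.map (Y n j)) := fun n j =>
    Measure.isProbabilityMeasure_map (hY n j).aemeasurable
  have hact := continuous_act (k := k) hφ
  -- A common bound for the characteristic functions of the units and of the limit law.
  set C' := max C (Γ.real Set.univ) with hC'
  have hC'0 : 0 ≤ C' := hC0.trans (le_max_left _ _)
  have hYC : ∀ n j t, ‖1 - charFun (P.map (Y n j)) t‖ ≤ C' * ‖t‖ ^ α := fun n j t =>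
    (norm_one_sub_charFun_network_le hC hα hσw hσb hφ hθ hlaw hind n j t).trans
      (by gcongr; exact le_max_left _ _)
  have hqC : ∀ t, ‖1 - charFun q t‖ ≤ C' * ‖t‖ ^ α := fun t =>
    (hst.norm_one_sub_charFun_le hα t).trans (by gcongr; exact le_max_right _ _)
  obtain ⟨r, K₁, K, hr1, hK₁0, hmom⟩ :=
    exists_integral_abs_inner_act_rpow_le k hα hC'0 hφ ha hb hβ0 hβ1 hgrowth
  let g : EuclideanSpace ℝ (Fin k) → EuclideanSpace ℝ (Fin k) → ℝ := fun t y =>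
    |inner ℝ (act φ y) t| ^ α
  have hg : ∀ t, Continuous (g t) := fun t =>
    (hact.inner continuous_const).abs.rpow_const fun _ => Or.inr hα.le
  have hg0 : ∀ t y, 0 ≤ g t y := fun t y => by positivity
  have hYg : ∀ n j t, Integrable (fun ω => g t (Y n j ω)) P ∧
      ∫ ω, g t (Y n j ω) ∂P ≤ K₁ * ‖t‖ ^ α := fun n j t => by
    have h1 := ((hmom _ (hYp n j) (hYC n j)).2 t).1
    rw [integral_map (hY n j).aemeasurable (hg t).measurable.aestronglyMeasurable] at h1
    exact ⟨h1.1.comp_measurable (hY n j), h1.2⟩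
  have hYgs : ∀ n j t, Integrable (fun ω => g t (Y n j ω) ^ r) P ∧
      ∫ ω, g t (Y n j ω) ^ r ∂P ≤ K * ‖t‖ ^ (α * r) := fun n j t => by
    have h1 := ((hmom _ (hYp n j) (hYC n j)).2 t).2
    rw [integral_map (hY n j).aemeasurable
      ((hg t).measurable.pow_const _).aestronglyMeasurable] at h1
    exact ⟨h1.1.comp_measurable (hY n j), h1.2⟩
  have hint : ∀ (n : ℕ) t,
      Integrable (fun ω => (n : ℝ)⁻¹ * ∑ j ∈ Finset.range n, g t (Y n j ω)) P := fun n t =>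
    (integrable_finsetSum _ fun j _ => (hYg n j t).1).const_mul _
  refine ⟨?_, ?_, fun t => ?_⟩
  · have h1 := isFiniteMeasure_smul_zeta (‖σb • ones k‖ ^ α) (ones k)
    have h2 : IsFiniteMeasure (mixture α σw φ q) :=
      isFiniteMeasure_mixture hφ (hmom q this hqC).1
    unfold spectral
    exact @isFiniteMeasureAdd _ _ _ _ h1 h2
  · refine ⟨σb ^ α * ‖ones k‖ ^ α + σw ^ α * K₁, by positivity, fun n t => ⟨?_, ?_⟩⟩
    · exact (integrable_const _).add ((hint n t).const_mul _)
    · have h1 : ∫ ω, (n : ℝ)⁻¹ * ∑ j ∈ Finset.range n, g t (Y n j ω) ∂P ≤ K₁ * ‖t‖ ^ α := by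
        rw [integral_const_mul, integral_finsetSum _ fun j _ => (hYg n j t).1]
        rcases Nat.eq_zero_or_pos n with rfl | hn
        · simpa using by positivity
        · rw [inv_mul_le_iff₀ (by positivity)]
          calc _ ≤ ∑ _j ∈ Finset.range n, K₁ * ‖t‖ ^ α :=
                Finset.sum_le_sum fun j _ => (hYg n j t).2
            _ = _ := by simp
      have h2 : |inner ℝ (ones k) t| ^ α ≤ ‖ones k‖ ^ α * ‖t‖ ^ α := by
        rw [← Real.mul_rpow (norm_nonneg _) (norm_nonneg _)]
        gcongr
        exact abs_real_inner_le_norm _ t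
      calc ∫ ω, condExponent α σw σb φ (fun p => θ p ω) X n (l + 1) hl t ∂P
          = σb ^ α * |inner ℝ (ones k) t| ^ α +
              σw ^ α * ∫ ω, (n : ℝ)⁻¹ * ∑ j ∈ Finset.range n, g t (Y n j ω) ∂P := by
            simp only [condExponent]
            rw [integral_add (integrable_const _) ((hint n t).const_mul _), integral_const,
              probReal_univ, one_smul, integral_const_mul]
        _ ≤ σb ^ α * (‖ones k‖ ^ α * ‖t‖ ^ α) + σw ^ α * (K₁ * ‖t‖ ^ α) := by gcongr
        _ = _ := by ring
  · have hqg := (hmom q this hqC).2 t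
    have h1 := tendsto_integral_abs_average_sub hY
      (fun f hf hfb => h.exists_tendsto_integral_mul_le hα hσw hσb hφ hθ hlaw hind hf hfb)
      (hg t) (hg0 t) hr1 (fun n j => hYgs n j t) hqg.2
    have h2 := h1.const_mul (σw ^ α)
    rw [mul_zero] at h2
    refine h2.congr fun n => ?_
    rw [integral_spectral_succ hα hσw hσb hφ X l t hqg.1.1, ← integral_const_mul]
    congr 1
    ext ω
    simp only [condExponent]
    rw [add_sub_add_left_eq_sub, ← mul_sub, abs_mul, abs_of_nonneg (Real.rpow_nonneg hσw α)]

theorem layerConverges (hα : 0 < α) (hσw : 0 ≤ σw) (hσb : 0 ≤ σb) (hθ : ∀ p, Measurable (θ p))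
    (hlaw : ∀ p, IsStableReal α (p.scale σw σb) (P.map (θ p))) (hind : iIndepFun θ P)
    (hφ : Continuous φ) {a b β : ℝ} (ha : 0 ≤ a) (hb : 0 ≤ b) (hβ0 : 0 < β) (hβ1 : β < 1)
    (hgrowth : ∀ s : ℝ, |φ s| ≤ a + b * |s| ^ β) :
    ∀ (l : ℕ) (hl : l < D), LayerConverges P α σw σb φ θ X l hl
  | 0, hl => layerConverges_zero hα hσw hσb hl
  | l + 1, hl =>
    (layerConverges hα hσw hσb hθ hlaw hind hφ ha hb hβ0 hβ1 hgrowth l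
      (Nat.lt_of_succ_lt hl)).succ hα hσw hσb hθ hlaw hind hφ ha hb hβ0 hβ1 hgrowth

end Induction

/-! ### The limit processes -/

/-- The vector with coordinates `y (ρ r)`. -/
noncomputable def reindex {k k' : ℕ} (ρ : Fin k' → Fin k) (y : EuclideanSpace ℝ (Fin k)) :
    EuclideanSpace ℝ (Fin k') := WithLp.toLp 2 fun r => y (ρ r)

theorem continuous_reindex {k k' : ℕ} (ρ : Fin k' → Fin k) : Continuous (reindex ρ) := by
  unfold reindex
  fun_prop

theorem network_submatrix {I D k k' : ℕ} (α : ℝ) (φ : ℝ → ℝ) (θ : Param I D → ℝ)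
    (X : Matrix (Fin I) (Fin k) ℝ) (ρ : Fin k' → Fin k) (n : ℕ) :
    ∀ (l : ℕ) (hl : l < D) (i : ℕ),
      network α φ θ (X.submatrix id ρ) n l hl i = reindex ρ (network α φ θ X n l hl i)
  | 0, hl, i => by
      ext r
      simp [network, reindex, row, ones, Matrix.submatrix]
  | l + 1, hl, i => by
      have ih := network_submatrix α φ θ X ρ n l (Nat.lt_of_succ_lt hl)
      ext r
      simp [network, ih, reindex, act, ones]

section LimitLaw

variable {Ω : Type*} [MeasurableSpace Ω] {P : Measure Ω} [IsProbabilityMeasure P] {I D : ℕ}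
  {α σw σb : ℝ} {φ : ℝ → ℝ} {θ : Param I D → Ω → ℝ}

theorem LayerConverges.tendsto_integral_unit {k l : ℕ} {hl : l < D}
    {X : Matrix (Fin I) (Fin k) ℝ} (h : LayerConverges P α σw σb φ θ X l hl)
    (hα : 0 < α) (hσw : 0 ≤ σw) (hσb : 0 ≤ σb) (hφ : Continuous φ) (hθ : ∀ p, Measurable (θ p))
    (hlaw : ∀ p, IsStableReal α (p.scale σw σb) (P.map (θ p))) (hind : iIndepFun θ P)
    {F : EuclideanSpace ℝ (Fin k) → ℝ} (hF : Continuous F) (hFb : ∃ M, ∀ x, |F x| ≤ M) :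
    Tendsto (fun n => ∫ ω, F (network α φ (fun p => θ p ω) X n l hl 0) ∂P) atTop
      (nhds (∫ x, F x ∂(stableLaw α (spectral α σw σb φ X l)))) := by
  have := (h.isStable hα hσw hσb hφ hθ hlaw hind).isProbabilityMeasure
  obtain ⟨M, hM⟩ := hFb
  have h1 := h.tendsto_integral_units hα hσw hσb hφ hθ hlaw hind (κ := Unit) (idx := fun _ => 0)
    (fun _ _ _ => rfl) (F := fun x => F (x ())) (hF.comp (continuous_apply ()))
    ⟨M, fun x => hM _⟩
  have h2 := (measurePreserving_eval (fun _ : Unit => stableLaw α (spectral α σw σb φ X l))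
    ()).map_eq
  rw [← h2, integral_map (measurable_pi_apply ()).aemeasurable hF.measurable.aestronglyMeasurable]
  exact h1

/-- The limit laws are consistent, because the networks are. -/
theorem map_reindex_stableLaw {l : ℕ} {hl : l < D}
    (h : ∀ (k : ℕ) (X : Matrix (Fin I) (Fin k) ℝ), LayerConverges P α σw σb φ θ X l hl)
    (hα : 0 < α) (hσw : 0 ≤ σw) (hσb : 0 ≤ σb) (hφ : Continuous φ) (hθ : ∀ p, Measurable (θ p))
    (hlaw : ∀ p, IsStableReal α (p.scale σw σb) (P.map (θ p))) (hind : iIndepFun θ P)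
    {k k' : ℕ} (X : Matrix (Fin I) (Fin k) ℝ) (ρ : Fin k' → Fin k) :
    (stableLaw α (spectral α σw σb φ X l)).map (reindex ρ) =
      stableLaw α (spectral α σw σb φ (X.submatrix id ρ) l) := by
  have := ((h k X).isStable hα hσw hσb hφ hθ hlaw hind).isProbabilityMeasure
  have := ((h k' (X.submatrix id ρ)).isStable hα hσw hσb hφ hθ hlaw hind).isProbabilityMeasure
  have hρ := continuous_reindex ρ
  have := Measure.isProbabilityMeasure_map (μ := stableLaw α (spectral α σw σb φ X l))
    hρ.aemeasurable
  refine ext_of_forall_integral_eq_of_IsFiniteMeasure fun F => ?_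
  have hFb : ∀ x, |F x| ≤ ‖F‖ := fun x => F.norm_coe_le_norm x
  have h1 := (h k X).tendsto_integral_unit hα hσw hσb hφ hθ hlaw hind (F.continuous.comp hρ)
    ⟨_, fun x => hFb _⟩
  have h2 := (h k' (X.submatrix id ρ)).tendsto_integral_unit hα hσw hσb hφ hθ hlaw hind
    F.continuous ⟨_, hFb⟩
  simp_rw [network_submatrix] at h2
  rw [integral_map hρ.aemeasurable F.continuous.measurable.aestronglyMeasurable]
  exact tendsto_nhds_unique h1 h2

/-- The matrix with the points of `J` as columns. -/
noncomputable def columnMatrix {I : ℕ} (J : Finset (Fin I → ℝ)) :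
    Matrix (Fin I) (Fin J.card) ℝ := fun i r => (J.equivFin.symm r).1 i

variable (α σw σb φ) in
/-- The law prescribed for the values of a limit process at the points of `J`. -/
noncomputable def finiteDimLaw (l : ℕ) (J : Finset (Fin I → ℝ)) : Measure (J → ℝ) :=
  (stableLaw α (spectral α σw σb φ (columnMatrix J) l)).map fun y x => y (J.equivFin x)

theorem measurable_eval_equivFin {I : ℕ} (J : Finset (Fin I → ℝ)) :
    Measurable fun (y : EuclideanSpace ℝ (Fin J.card)) (x : J) => y (J.equivFin x) := by
  fun_prop

theorem isProjectiveMeasureFamily_finiteDimLaw {l : ℕ} {hl : l < D}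
    (h : ∀ (k : ℕ) (X : Matrix (Fin I) (Fin k) ℝ), LayerConverges P α σw σb φ θ X l hl)
    (hα : 0 < α) (hσw : 0 ≤ σw) (hσb : 0 ≤ σb) (hφ : Continuous φ) (hθ : ∀ p, Measurable (θ p))
    (hlaw : ∀ p, IsStableReal α (p.scale σw σb) (P.map (θ p))) (hind : iIndepFun θ P) :
    IsProjectiveMeasureFamily (α := fun _ : Fin I → ℝ => ℝ) (finiteDimLaw α σw σb φ l) := by
  intro J K hKJ
  let ρ : Fin K.card → Fin J.card := fun r =>
    J.equivFin ⟨(K.equivFin.symm r).1, hKJ (K.equivFin.symm r).2⟩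
  have hX : (columnMatrix J).submatrix id ρ = columnMatrix K := by
    ext i r
    simp [columnMatrix, ρ]
  unfold finiteDimLaw
  refine Eq.trans ?_ (Measure.map_map (Finset.measurable_restrict₂ (X := fun _ => ℝ) hKJ)
    (measurable_eval_equivFin J)).symm
  rw [← hX, ← map_reindex_stableLaw h hα hσw hσb hφ hθ hlaw hind, Measure.map_map
      (measurable_eval_equivFin K) (continuous_reindex ρ).measurable]
  congr 1
  ext y x
  simp [reindex, ρ, Finset.restrict₂]

theorem measurable_evalColumns {I k : ℕ} (X : Matrix (Fin I) (Fin k) ℝ) :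
    Measurable (evalColumns X) := by
  unfold evalColumns
  fun_prop

/-- A process on `ℝ^I` with the limit laws as its finite-dimensional distributions. -/
theorem exists_map_evalColumns_eq {l : ℕ} {hl : l < D}
    (h : ∀ (k : ℕ) (X : Matrix (Fin I) (Fin k) ℝ), LayerConverges P α σw σb φ θ X l hl)
    (hα : 0 < α) (hσw : 0 ≤ σw) (hσb : 0 ≤ σb) (hφ : Continuous φ) (hθ : ∀ p, Measurable (θ p))
    (hlaw : ∀ p, IsStableReal α (p.scale σw σb) (P.map (θ p))) (hind : iIndepFun θ P) :
    ∃ μ : Measure ((Fin I → ℝ) → ℝ), IsProbabilityMeasure μ ∧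
      ∀ (k : ℕ) (X : Matrix (Fin I) (Fin k) ℝ),
        μ.map (evalColumns X) = stableLaw α (spectral α σw σb φ X l) := by
  have hprob : ∀ J, IsProbabilityMeasure (finiteDimLaw (I := I) α σw σb φ l J) := fun J => by
    have := ((h _ (columnMatrix J)).isStable hα hσw hσb hφ hθ hlaw hind).isProbabilityMeasure
    exact Measure.isProbabilityMeasure_map (measurable_eval_equivFin J).aemeasurable
  obtain ⟨μ, hμ⟩ := exists_isProjectiveLimit
    (isProjectiveMeasureFamily_finiteDimLaw h hα hσw hσb hφ hθ hlaw hind)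
  refine ⟨μ, hμ.isProbabilityMeasure, fun k X => ?_⟩
  classical
  -- The columns of `X` may repeat, so `X` is obtained by reindexing from the set of its columns.
  let J : Finset (Fin I → ℝ) := Finset.univ.image fun (r : Fin k) j => X j r
  have hJ : ∀ r, (fun j => X j r) ∈ J := fun r => Finset.mem_image_of_mem _ (Finset.mem_univ r)
  let ρ : Fin k → Fin J.card := fun r => J.equivFin ⟨fun j => X j r, hJ r⟩
  have hX : (columnMatrix J).submatrix id ρ = X := by
    ext i r
    simp [columnMatrix, ρ]
  let e : (J → ℝ) → EuclideanSpace ℝ (Fin k) := fun u =>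
    WithLp.toLp 2 fun r => u ⟨fun j => X j r, hJ r⟩
  have he : Measurable e := by fun_prop
  calc μ.map (evalColumns X) = (μ.map J.restrict).map e := by
        rw [Measure.map_map he (Finset.measurable_restrict J)]
        rfl
    _ = (stableLaw α (spectral α σw σb φ (columnMatrix J) l)).map (reindex ρ) := by
        rw [hμ J, finiteDimLaw, Measure.map_map he (measurable_eval_equivFin J)]
        rfl
    _ = _ := by rw [map_reindex_stableLaw h hα hσw hσb hφ hθ hlaw hind, hX]

end LimitLaw

end DeepStable

theorem theorem2 {Ω : Type*} [MeasurableSpace Ω] (P : Measure Ω) [IsProbabilityMeasure P]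
    (I D : ℕ) (hI : 1 ≤ I) (hD : 1 ≤ D)
    (α σw σb : ℝ) (hα0 : 0 < α) (hα2 : α < 2) (hσw : 0 ≤ σw) (hσb : 0 ≤ σb)
    (θ : DeepStable.Param I D → Ω → ℝ)
    (hθ_meas : ∀ p, Measurable (θ p))
    (hθ_law : ∀ p, DeepStable.IsStableReal α (p.scale σw σb) (P.map (θ p)))
    (hθ_indep : iIndepFun θ P)
    (φ : ℝ → ℝ) (hφ : Continuous φ)
    (a b β : ℝ) (ha : 0 < a) (hb : 0 < b) (hβ0 : 0 < β) (hβ1 : β < 1)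
    (hφ_growth : ∀ s : ℝ, |φ s| ≤ a + b * |s| ^ β)
    (l : ℕ) (hl : l < D) :
    ∃ (Ω' : Type) (_ : MeasurableSpace Ω') (P' : Measure Ω') (_ : IsProbabilityMeasure P')
      (F : ℕ → (Fin I → ℝ) → Ω' → ℝ),
      (∀ i, DeepStable.IsStableProcess α
        (fun _ X => DeepStable.spectral α σw σb φ X l) (F i) P') ∧
      iIndepFun (fun (i : ℕ) (ω : Ω') (x : Fin I → ℝ) => F i x ω) P' ∧
      ∀ k : ℕ, 1 ≤ k → ∀ X : Matrix (Fin I) (Fin k) ℝ,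
        HasLaw (fun ω i => DeepStable.evalColumns X fun x => F i x ω)
          (Measure.infinitePi fun _ : ℕ =>
            DeepStable.stableLaw α (DeepStable.spectral α σw σb φ X l)) P' ∧
        TendstoInDistribution
          (fun (n : ℕ) (ω : Ω) (i : ℕ) =>
            DeepStable.network α φ (fun p => θ p ω) X n l hl i)
          atTop
          (fun ω i => DeepStable.evalColumns X fun x => F i x ω)
          (fun _ => P) P' := by
  have h : ∀ (k : ℕ) (X : Matrix (Fin I) (Fin k) ℝ),
      DeepStable.LayerConverges P α σw σb φ θ X l hl :=
    fun k X => DeepStable.layerConverges hα0 hσw hσb hθ_meas hθ_law hθ_indep hφ ha.le hb.le hβ0 hβ1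
      hφ_growth l hl
  have hst := fun k X => (h k X).isStable hα0 hσw hσb hφ hθ_meas hθ_law hθ_indep
  obtain ⟨μ, hμ, hμX⟩ := DeepStable.exists_map_evalColumns_eq h hα0 hσw hσb hφ hθ_meas hθ_law
    hθ_indep
  have hZm : ∀ {k : ℕ} (X : Matrix (Fin I) (Fin k) ℝ), Measurable
      fun (ω : ℕ → (Fin I → ℝ) → ℝ) i => DeepStable.evalColumns X (ω i) := fun X =>
    measurable_pi_lambda _ fun i => (DeepStable.measurable_evalColumns X).comp
      (measurable_pi_apply i)
  have hmap : ∀ {k : ℕ} (X : Matrix (Fin I) (Fin k) ℝ),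
      (Measure.infinitePi fun _ : ℕ => μ).map (fun ω i => DeepStable.evalColumns X (ω i)) =
        Measure.infinitePi fun _ : ℕ =>
          DeepStable.stableLaw α (DeepStable.spectral α σw σb φ X l) := fun X => by
    rw [Measure.infinitePi_map_pi (fun _ : ℕ => μ)
      fun _ => DeepStable.measurable_evalColumns X, hμX]
  refine ⟨ℕ → (Fin I → ℝ) → ℝ, inferInstance, Measure.infinitePi fun _ => μ, inferInstance,
    fun i x ω => ω i x, fun i => ⟨fun x => by fun_prop, fun k _ X => ?_⟩, ?_,
    fun k _ X => ⟨⟨(hZm X).aemeasurable, hmap X⟩, ?_⟩⟩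
  · have h1 : (Measure.infinitePi fun _ : ℕ => μ).map
        (fun ω => DeepStable.evalColumns X fun x => ω i x) =
        DeepStable.stableLaw α (DeepStable.spectral α σw σb φ X l) := by
      rw [← hμX k X]
      conv_rhs => rw [← Measure.infinitePi_map_eval (fun _ : ℕ => μ) i]
      rw [Measure.map_map (DeepStable.measurable_evalColumns X) (measurable_pi_apply i)]
      rfl
    rw [h1]
    exact hst k X
  · exact iIndepFun_infinitePi (P := fun _ : ℕ => μ) (X := fun _ f => f) fun _ => measurable_id
  · have hq := (hst k X).isProbabilityMeasure
    refine DeepStable.tendstoInDistribution_of_forall_initial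
      (fun n => measurable_pi_lambda _ fun i =>
        DeepStable.measurable_network hφ X n l hl (fun p _ => hθ_meas p) i) (hZm X)
      fun m F hF hFb => ?_
    have h1 := (h k X).tendsto_integral_units hα0 hσw hσb hφ hθ_meas hθ_law hθ_indep
      (idx := fun a : Fin m => (a : ℕ)) Fin.val_injective hF hFb
    have hr : Measurable fun (ω : ℕ → EuclideanSpace ℝ (Fin k)) (a : Fin m) => ω a := by fun_prop
    have hFr : Measurable fun ω : ℕ → EuclideanSpace ℝ (Fin k) => F fun a => ω a :=
      hF.measurable.comp hr
    have h2 : ((Measure.infinitePi fun _ : ℕ => μ).map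
        fun ω i => DeepStable.evalColumns X (ω i)).map (fun ω (a : Fin m) => ω a) =
        Measure.pi fun _ : Fin m =>
          DeepStable.stableLaw α (DeepStable.spectral α σw σb φ X l) := by
      rw [hmap X, Measure.map_infinitePi_infinitePi_of_inj Fin.val_injective,
        Measure.infinitePi_eq_pi]
    rw [← h2, integral_map hr.aemeasurable hF.measurable.aestronglyMeasurable,
      integral_map (hZm X).aemeasurable hFr.aestronglyMeasurable] at h1
    exact h1
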